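/- Let $A$ be an abelian structure, i.e. an abelian group $(A,+,-,0)$ with a family $\mathcal S$ of distinguished subgroups of finite powers $A^n$, regarded as a first order structure (with equality) in the language $L^-$ with symbols $+,-,0$ and a predicate for each member of $\mathcal S$. Let $f:A\to\mathbb T$ be a homomorphism to a compact Hausdorff commutative topological group. A *CL-structure* is a triple $N=(N^-,g,\mathbb T)$ with $N^-$ an $L^-$-structure and $g:N^-\to\mathbb T$ any map. *CL-formulas*, with variables ranging over $N^-$, are built from first order $L^-$-formulas and formulas $(f(t_1),\dots,f(t_k))\in D$ ($t_i$ being $L^-$-terms, $D\subseteq\mathbb T^k$ closed) by $\wedge,\vee,\exists,\forall$; in $N$ the symbol $f$ is interpreted as $g$. An *approximation* to a CL-formula $\phi$ is a formula obtained by replacing each occurrence of a closed set $D$ in $\phi$ by a closed set $D'$ such that $D\subseteq U\subseteq D'$ for some open $U$; first order formulas are left unchanged. $N\models_{approx}\phi(\bar a)$ means that $N\models\phi'(\bar a)$ for all approximations $\phi'$ to $\phi$. Let $T$ be the set of CL-sentences $\sigma$ with $(A,f,\mathbb T)\models_{approx}\sigma$; an *approximate model* of $T$ is a CL-structure $N$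 with $N\models_{approx}\sigma$ for all $\sigma\in T$. For a cardinal $\kappa$, $N$ is *$\kappa$-saturated* if every collection $\Gamma(\bar x)$ of CL-formulas in a finite tuple $\bar x$ over a set of fewer than $\kappa$ parameters from $N^-$, such that $N\models_{approx}\exists\bar x\bigwedge\Gamma'(\bar x)$ for every finite $\Gamma'\subseteq\Gamma$, is realized in $N$. A *pp-formula* is a formula $\exists\bar y\,\phi(\bar x,\bar y)$ with $\phi$ a finite conjunction of atomic $L^-$-formulas. A *pp\*-formula* is a CL-formula $$\exists\bar y\Big(\phi(\bar x,\bar y)\wedge\bigwedge_{i\in I}f(x_i)=c_i\wedge\bigwedge_{j\in J}f(y_j)=d_j\Big)$$ with $\phi$ as before, $I,J$ sets of indices, and $c_i,d_j\in\mathbb T$. Let $\Phi$ be the smallest collection of CL-formulas that contains the pp\*-formulas and the negations of pp-formulas and is closed under $\wedge$, $\vee$ and passing to approximations. Then for every CL-formula $\phi(\bar x)$ and every approximation $\phi'(\bar x)$ to it there is a formula $\theta(\bar x)\in\Phi$ such that, for every approximate model $N$ of $T$ and every tuple $\bar a$ from $N^-$: 1. if $N$ is $\kappa$-saturated for some infinite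 cardinal $\kappa$, then $N\models\phi(\bar a)$ implies $N\models\theta(\bar a)$, and $N\models\theta(\bar a)$ implies $N\models\phi'(\bar a)$; 2. in any case, $N\models_{approx}\phi(\bar a)$ implies $N\models_{approx}\theta(\bar a)$, and $N\models_{approx}\theta(\bar a)$ implies $N\models_{approx}\phi'(\bar a)$. -/

import Mathlib

open TopologicalSpace

universe u v w x y

/-! ### Continuous logic for a first order structure with a map to a space `C` -/

/-- CL-formulas over the first order language `L` and the space `C`, with free variables indexed by
`α` together with `n` further variables indexed by `Fin n` (conventions of
`FirstOrder.Language.BoundedFormula`). All variables range over the first order sort.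
* `fo φ`: a first order `L`-formula `φ`;
* `mem D ts`: the formula `(f(t₁), …, f(t_k)) ∈ D`, for `L`-terms `tᵢ` and a closed `D ⊆ C^k`;
* conjunction, disjunction, existential and universal quantification. -/
inductive CLFormula (L : FirstOrder.Language.{u, v}) (C : Type w) [TopologicalSpace C] (α : Type x) :
    ℕ → Type (max u v w x)
  | fo {n : ℕ} (φ : L.BoundedFormula α n) : CLFormula L C α n
  | mem {n k : ℕ} (D : Closeds (Fin k → C)) (ts : Fin k → L.Term (α ⊕ Fin n)) : CLFormula L C α n
  | and {n : ℕ} (φ ψ : CLFormula L C α n) : CLFormula L C α n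
  | or {n : ℕ} (φ ψ : CLFormula L C α n) : CLFormula L C α n
  | ex {n : ℕ} (φ : CLFormula L C α (n + 1)) : CLFormula L C α n
  | all {n : ℕ} (φ : CLFormula L C α (n + 1)) : CLFormula L C α n

/-- A CL-structure `(N, f, C)`: a first order `L`-structure `N` and a map `f` from its universe
to the fixed space `C`. -/
structure CLStructure (L : FirstOrder.Language.{u, v}) (C : Type w) where
  carrier : Type y
  str : L.Structure carrier
  toFun : carrier → C

attribute [instance] CLStructure.str

/-- `D'` is a closed neighbourhood of the closed set `D`. -/
def ClosedApprox {X : Type w} [TopologicalSpace X] (D D' : Closeds X) : Prop :=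
  ∃ U : Set X, IsOpen U ∧ (D : Set X) ⊆ U ∧ U ⊆ (D' : Set X)

namespace CLFormula

variable {L : FirstOrder.Language.{u, v}} {C : Type w} [TopologicalSpace C] {α : Type x}

/-- Satisfaction of a CL-formula in a CL-structure. -/
def Realize (N : CLStructure.{u, v, w, y} L C) :
    {n : ℕ} → CLFormula L C α n → (α → N.carrier) → (Fin n → N.carrier) → Prop
  | _, fo φ, a, b => φ.Realize a b
  | _, mem D ts, a, b => (fun i => N.toFun ((ts i).realize (Sum.elim a b))) ∈ D
  | _, and φ ψ, a, b => φ.Realize N a b ∧ ψ.Realize N a b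
  | _, or φ ψ, a, b => φ.Realize N a b ∨ ψ.Realize N a b
  | _, ex φ, a, b => ∃ c, φ.Realize N a (Fin.snoc b c)
  | _, all φ, a, b => ∀ c, φ.Realize N a (Fin.snoc b c)

/-- `Approx φ φ'`: the formula `φ'` is an approximation to `φ`, i.e. it arises from `φ` by replacing
every occurrence of a closed set by an approximation (closed neighbourhood) to it. -/
inductive Approx : {n : ℕ} → CLFormula L C α n → CLFormula L C α n → Prop
  | fo {n : ℕ} (φ : L.BoundedFormula α n) : Approx (fo φ) (fo φ)
  | mem {n k : ℕ} {D D' : Closeds (Fin k → C)} (h : ClosedApprox D D')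
      (ts : Fin k → L.Term (α ⊕ Fin n)) : Approx (mem D ts) (mem D' ts)
  | and {n : ℕ} {φ φ' ψ ψ' : CLFormula L C α n} (h₁ : Approx φ φ') (h₂ : Approx ψ ψ') :
      Approx (and φ ψ) (and φ' ψ')
  | or {n : ℕ} {φ φ' ψ ψ' : CLFormula L C α n} (h₁ : Approx φ φ') (h₂ : Approx ψ ψ') :
      Approx (or φ ψ) (or φ' ψ')
  | ex {n : ℕ} {φ φ' : CLFormula L C α (n + 1)} (h : Approx φ φ') : Approx (ex φ) (ex φ')
  | all {n : ℕ} {φ φ' : CLFormula L C α (n + 1)} (h : Approx φ φ') : Approx (all φ) (all φ')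

/-- Approximate satisfaction: all approximations to the formula are satisfied. -/
def ApproxRealize (N : CLStructure.{u, v, w, y} L C) {n : ℕ} (φ : CLFormula L C α n)
    (a : α → N.carrier) (b : Fin n → N.carrier) : Prop :=
  ∀ φ' : CLFormula L C α n, φ.Approx φ' → φ'.Realize N a b

/-- Finite conjunctions (the empty one is the true first order formula). -/
def conj {n : ℕ} : List (CLFormula L C α n) → CLFormula L C α n
  | [] => fo ⊤
  | φ :: l => and φ (conj l)

/-- Existential quantification over all variables indexed by `Fin n`. -/
def exs : {n : ℕ} → CLFormula L C α n → CLFormula L C α 0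
  | 0, φ => φ
  | _ + 1, φ => exs (ex φ)

end CLFormula

namespace CLStructure

variable {L : FirstOrder.Language.{u, v}} {C : Type w} [TopologicalSpace C]

/-- The CL-theory of `M`: the CL-sentences that are approximately true in `M`. -/
def theory (M : CLStructure.{u, v, w, y} L C) : Set (CLFormula L C Empty 0) :=
  {σ | σ.ApproxRealize M Empty.elim Fin.elim0}

/-- `N` is an approximate model of the set `T` of CL-sentences. -/
def IsApproxModel (N : CLStructure.{u, v, w, y} L C) (T : Set (CLFormula L C Empty 0)) : Prop :=
  ∀ σ ∈ T, σ.ApproxRealize N Empty.elim Fin.elim0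

/-- `N` is `κ`-saturated: every collection `Γ(x₁, …, xₙ)` of CL-formulas over a set `B` of fewer
than `κ` elements of `N` that is finitely approximately satisfiable in `N` (that is,
`∃ x₁ … xₙ ⋀ Γ'` is approximately true in `N` for every finite part `Γ'` of `Γ`) is realized in `N`.
The elements of `B` serve as their own names. -/
def IsSaturated (κ : Cardinal.{y}) (N : CLStructure.{u, v, w, y} L C) : Prop :=
  ∀ B : Set N.carrier, Cardinal.mk B < κ → ∀ (n : ℕ) (Γ : Set (CLFormula L C B n)),
    (∀ l : List (CLFormula L C B n), (∀ φ ∈ l, φ ∈ Γ) →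
      (CLFormula.conj l).exs.ApproxRealize N Subtype.val Fin.elim0) →
    ∃ b : Fin n → N.carrier, ∀ φ ∈ Γ, φ.Realize N Subtype.val b

end CLStructure

/-! ### Abelian structures -/

/-- The function symbols `0`, `-`, `+`. -/
inductive AbelianFunctions : ℕ → Type
  | zero : AbelianFunctions 0
  | neg : AbelianFunctions 1
  | add : AbelianFunctions 2

/-- The language of abelian structures: `0`, `-`, `+` and `n`-ary relation symbols `S n`. -/
def abelianLanguage (S : ℕ → Type v) : FirstOrder.Language.{0, v} where
  Functions := AbelianFunctions
  Relations := S

/-- An abelian group with a family of distinguished subgroups of its finite powers, as a first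
order structure. -/
abbrev abelianStructure {S : ℕ → Type v} {A : Type y} [AddCommGroup A]
    (P : ∀ n, S n → AddSubgroup (Fin n → A)) : (abelianLanguage S).Structure A where
  funMap := fun {_} F a =>
    match F, a with
    | AbelianFunctions.zero, _ => 0
    | AbelianFunctions.neg, a => -(a 0)
    | AbelianFunctions.add, a => a 0 + a 1
  RelMap := fun {n} R a => a ∈ P n R

/-- The CL-structure `(A, f, 𝕋)` given by an abelian structure `A` and a homomorphism `f`. -/
def abelianCLStructure {S : ℕ → Type v} {A : Type y} [AddCommGroup A]
    (P : ∀ n, S n → AddSubgroup (Fin n → A)) {𝕋 : Type w} [AddCommGroup 𝕋] (f : A →+ 𝕋) :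
    CLStructure.{0, v, w, y} (abelianLanguage S) 𝕋 where
  carrier := A
  str := abelianStructure P
  toFun := f

section PP

variable {L : FirstOrder.Language.{u, v}}

/-- (Nonempty) finite conjunctions of atomic first order formulas. -/
inductive IsAtomicConj {α : Type x} {n : ℕ} : L.BoundedFormula α n → Prop
  | atomic {φ : L.BoundedFormula α n} (h : φ.IsAtomic) : IsAtomicConj φ
  | and {φ ψ : L.BoundedFormula α n} (h₁ : IsAtomicConj φ) (h₂ : IsAtomicConj ψ) :
      IsAtomicConj (φ ⊓ ψ)

/-- Positive primitive formulas `∃ ȳ φ(x̄, ȳ)`, with `φ` a finite conjunction of atomic formulas. -/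
def IsPP {α : Type x} (ψ : L.Formula α) : Prop :=
  ∃ (k : ℕ) (φ : L.BoundedFormula α k), IsAtomicConj φ ∧ ψ = φ.exs

variable {C : Type w} [TopologicalSpace C] [T1Space C]

/-- The CL-formula `f(z) = c`, for a variable `z`. -/
def valueEq {α : Type x} {n : ℕ} (z : α ⊕ Fin n) (c : C) : CLFormula L C α n :=
  CLFormula.mem (k := 1) ⟨{fun _ => c}, isClosed_singleton⟩ (fun _ => FirstOrder.Language.Term.var z)

/-- `pp*`-formulas in `x₁, …, x_m`:
`∃ ȳ (φ(x̄, ȳ) ∧ ⋀_{i ∈ I} f(x_i) = c_i ∧ ⋀_{j ∈ J} f(y_j) = d_j)` with `φ` a finite conjunction of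
atomic first order formulas. -/
def IsPPStar {m : ℕ} (ψ : CLFormula L C (Fin m) 0) : Prop :=
  ∃ (k : ℕ) (φ : L.BoundedFormula (Fin m) k) (I : Finset (Fin m)) (c : Fin m → C)
    (J : Finset (Fin k)) (d : Fin k → C), IsAtomicConj φ ∧
    ψ = CLFormula.exs
      (CLFormula.and (CLFormula.fo φ)
        (CLFormula.and
          (CLFormula.conj (((List.finRange m).filter (· ∈ I)).map
            fun i => valueEq (Sum.inl i) (c i)))
          (CLFormula.conj (((List.finRange k).filter (· ∈ J)).map
            fun j => valueEq (Sum.inr j) (d j)))))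

/-- The collection `Φ` of CL-formulas in `x₁, …, x_m` obtained from `pp*`-formulas and negated
`pp`-formulas by closing under `∧`, `∨` and approximations. -/
inductive InPPClosure {m : ℕ} : CLFormula L C (Fin m) 0 → Prop
  | ppStar {ψ : CLFormula L C (Fin m) 0} (h : IsPPStar ψ) : InPPClosure ψ
  | negPP {ψ : L.Formula (Fin m)} (h : IsPP ψ) :
      InPPClosure (CLFormula.fo (FirstOrder.Language.BoundedFormula.not ψ))
  | and {φ ψ : CLFormula L C (Fin m) 0} (h₁ : InPPClosure φ) (h₂ : InPPClosure ψ) :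
      InPPClosure (CLFormula.and φ ψ)
  | or {φ ψ : CLFormula L C (Fin m) 0} (h₁ : InPPClosure φ) (h₂ : InPPClosure ψ) :
      InPPClosure (CLFormula.or φ ψ)
  | approx {φ φ' : CLFormula L C (Fin m) 0} (h₁ : InPPClosure φ) (h₂ : φ.Approx φ') :
      InPPClosure φ'

end PP

/-!
Interpolation holds already without saturation: for every CL-formula `φ` and every approximation
`φ'` to it there are `θ ∈ Φ` and an approximation `θ'` to `θ` such that `φ → θ` and `θ' → φ'` in all
approximate models (`exists_inPPClosure_of_approx`). Both parts of the theorem follow, applying this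
to a formula `ψ` between `φ` and `φ'`.

The axioms of abelian structures and the additivity of `f` belong to the theory, so an approximate
model is an abelian structure with a homomorphism to `𝕋` (`exists_eq_abelianCLStructure`). In such a
structure a pp-formula `ψ(a, z)` defines a coset, if anything, of the subgroup `ψ(0, z)`, and the
values of `f` on that coset are dense in a coset of the limit group of `ψ(0, z)`, the closure of the
set of values of `f` on it. Limit groups and the indices of pp-definable subgroups in each other are
the same in all approximate models (`AbelianModel.limitGroup_eq`, `AbelianModel.relIndex_eq`).

Call a pair `(R, R')` of predicates on the approximate models interpolated (`Interpolates`) if a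
positive combination of negated pp-formulas and of formulas `∃ z (ψ(a, z) ∧ f(a, z) ∈ D)` follows
from `R` while some approximation to it implies `R'`. This is closed under the following operations.
* Negation (`Interpolates.not`): as the values on a coset are dense in a coset of a limit group,
  whether `f(a, z) ∈ D` for some `z` with `ψ(a, z)` is decided, up to approximation, by the value of
  `f` at any single point of the coset.
* Existential quantification (`Interpolates.ex`): the quantifier has to be eliminated from
  `∃ z (ψ(a, z) ∧ f(a, z) ∈ D ∧ ⋀ⱼ ¬χⱼ(a, z))`. Those `χⱼ` whose subgroup has infinite index in that
  of `ψ` can be dropped: a condition on the values of `f` defines a set finitely many translates of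
  which cover the subgroup, and by Neumann's lemma such a set is not covered by finitely many cosets
  of subgroups of infinite index (`exists_relIndex_ne_zero_of_cover`). If the indices are finite,
  the cosets of the intersection of all the subgroups on which `ψ` and no `χⱼ` holds, and on which
  the values of `f` are as required, are counted by inclusion-exclusion
  (`exists_avoiding_iff_sum_pos`). The count depends only on which intersections of the cosets are
  nonempty and on the values of `f` at points of them, modulo limit groups. The latter information
  is insensitive to small changes, since the limit groups in question have finite index in one
  another.

By induction on formulas every approximation `φ < φ'` is interpolated (`interpolates_approx`).
Finally, a closed subset `D` of a power of `𝕋` lies in a finite union of boxes inside a given closed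
neighbourhood of it, and `∃ z (ψ(a, z) ∧ f(a, z) ∈ D)` with `D` a box around a point is an
approximation to a `pp*`-formula (`exists_inPPClosure_ppValue`).
-/

/-! ### Closed neighbourhoods of closed sets -/

section Topology

/-- `D'` is a closed neighbourhood of the closed set `D`. -/
structure ClosedNhd {X : Type*} [TopologicalSpace X] (D D' : Set X) : Prop where
  isClosed : IsClosed D
  isClosed' : IsClosed D'
  subset_interior : D ⊆ interior D'

namespace ClosedNhd

variable {X Y : Type*} [TopologicalSpace X] [TopologicalSpace Y] {D D' E E' : Set X}

theorem subset (h : ClosedNhd D D') : D ⊆ D' := h.subset_interior.trans interior_subset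

theorem univ : ClosedNhd (Set.univ : Set X) Set.univ :=
  ⟨isClosed_univ, isClosed_univ, by simp⟩

theorem inter (h : ClosedNhd D D') (h' : ClosedNhd E E') : ClosedNhd (D ∩ E) (D' ∩ E') :=
  ⟨h.1.inter h'.1, h.2.inter h'.2, by
    rw [interior_inter]; exact Set.inter_subset_inter h.3 h'.3⟩

theorem iInter {ι : Type*} [Finite ι] {D D' : ι → Set X} (h : ∀ i, ClosedNhd (D i) (D' i)) :
    ClosedNhd (⋂ i, D i) (⋂ i, D' i) :=
  ⟨isClosed_iInter fun i => (h i).1, isClosed_iInter fun i => (h i).2, by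
    rw [interior_iInter_of_finite]; exact Set.iInter_mono fun i => (h i).3⟩

theorem preimage (h : ClosedNhd D D') {g : Y → X} (hg : Continuous g) :
    ClosedNhd (g ⁻¹' D) (g ⁻¹' D') :=
  ⟨h.1.preimage hg, h.2.preimage hg,
    (Set.preimage_mono h.3).trans (preimage_interior_subset_interior_preimage hg)⟩

theorem exists_between [NormalSpace X] (h : ClosedNhd D D') :
    ∃ E, ClosedNhd D E ∧ ClosedNhd E D' := by
  obtain ⟨U, hU, hDU, hUD⟩ := normal_exists_closure_subset h.1 isOpen_interior h.3
  exact ⟨closure U, ⟨h.1, isClosed_closure, hDU.trans (hU.subset_interior_iff.2 subset_closure)⟩,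
    ⟨isClosed_closure, h.2, hUD⟩⟩

/-- In a normal space, disjoint closed sets have a closed neighbourhood of one of them that is
disjoint from the other. -/
theorem exists_disjoint [NormalSpace X] (hD : IsClosed D) (hE : IsClosed E) (h : Disjoint D E) :
    ∃ D', ClosedNhd D D' ∧ Disjoint D' E := by
  obtain ⟨U, hU, hDU, hUE⟩ := normal_exists_closure_subset hD hE.isOpen_compl
    (Set.subset_compl_iff_disjoint_right.2 h)
  exact ⟨closure U, ⟨hD, isClosed_closure, hDU.trans (hU.subset_interior_iff.2 subset_closure)⟩,
    Set.subset_compl_iff_disjoint_right.1 hUE⟩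

theorem closedApprox {D D' : Closeds X} (h : ClosedNhd (D : Set X) D') : ClosedApprox D D' :=
  ⟨interior D', isOpen_interior, h.3, interior_subset⟩

theorem of_closedApprox {D D' : Closeds X} (h : ClosedApprox D D') :
    ClosedNhd (D : Set X) D' := by
  obtain ⟨U, hU, h1, h2⟩ := h
  exact ⟨D.isClosed, D'.isClosed, h1.trans (interior_maximal h2 hU)⟩

/-- In a normal space, a point that lies in all closed neighbourhoods of a closed set lies in the
set. -/
theorem mem_of_forall [T4Space X] (hD : IsClosed D) {a : X}
    (h : ∀ D', ClosedNhd D D' → a ∈ D') : a ∈ D := by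
  by_contra ha
  obtain ⟨D', h1, h2⟩ := exists_disjoint hD (isClosed_singleton (x := a)) (by simpa using ha)
  exact Set.disjoint_left.1 h2 (h D' h1) rfl

end ClosedNhd
end Topology

/-! ### Cosets and indices of subgroups -/

section Groups

variable {V W : Type*} [AddCommGroup V] [AddCommGroup W]

/-- Finite index, expressed by `relIndex ≠ 0` (the relative index `0` stands for infinity), gives
finitely many representatives of the cosets. -/
theorem AddSubgroup.exists_finset_cover_of_relIndex_ne_zero {H G : AddSubgroup V}
    (h : H.relIndex G ≠ 0) : ∃ s : Finset V, (∀ t ∈ s, t ∈ G) ∧ ∀ g ∈ G, ∃ t ∈ s, g - t ∈ H := by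
  classical
  have : Finite (G ⧸ H.addSubgroupOf G) := by
    apply Nat.finite_of_card_ne_zero
    exact h
  have := Fintype.ofFinite (G ⧸ H.addSubgroupOf G)
  refine ⟨Finset.univ.image fun q : G ⧸ H.addSubgroupOf G => (q.out : V), ?_, ?_⟩
  · intro t ht
    obtain ⟨q, -, rfl⟩ := Finset.mem_image.1 ht
    exact q.out.2
  · intro g hg
    refine ⟨_, Finset.mem_image_of_mem _ (Finset.mem_univ (QuotientAddGroup.mk ⟨g, hg⟩)), ?_⟩
    have := QuotientAddGroup.mk_out_eq_add (H.addSubgroupOf G) ⟨g, hg⟩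
    obtain ⟨k, hk⟩ := this
    rw [hk]
    simpa using AddSubgroup.mem_addSubgroupOf.1 k.2

theorem AddSubgroup.natCast_le_card_quotient_iff (H G : AddSubgroup V) (n : ℕ) :
    (n : ℕ∞) ≤ ENat.card (G ⧸ H.addSubgroupOf G) ↔
      ∃ z : Fin n → V, (∀ i, z i ∈ G) ∧ ∀ i j, i ≠ j → z i - z j ∉ H := by
  rw [ENat.card, Cardinal.natCast_le_toENat]
  have : (n : Cardinal) ≤ Cardinal.mk (G ⧸ H.addSubgroupOf G) ↔
      Nonempty (Fin n ↪ G ⧸ H.addSubgroupOf G) := by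
    rw [← Cardinal.lift_mk_le', Cardinal.mk_fin]; simp
  rw [this]
  have hmk : ∀ a b : G, (QuotientAddGroup.mk a : G ⧸ H.addSubgroupOf G) = QuotientAddGroup.mk b ↔
      (b - a : V) ∈ H := by
    intro a b
    rw [QuotientAddGroup.eq, AddSubgroup.mem_addSubgroupOf]
    simp [neg_add_eq_sub]
  constructor
  · rintro ⟨e⟩
    refine ⟨fun i => ((e i).out : G), fun i => (e i).out.2, fun i j hij h => hij ?_⟩
    have := (hmk _ _).2 h
    simp only [QuotientAddGroup.out_eq'] at this
    exact (e.injective this).symm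
  · rintro ⟨z, hz, hne⟩
    refine ⟨⟨fun i => QuotientAddGroup.mk ⟨z i, hz i⟩, fun i j hij => ?_⟩⟩
    by_contra h
    exact hne j i (Ne.symm h) ((hmk _ _).1 hij)

/-- The relative index of subgroups is determined by the sizes of finite families of pairwise
incongruent elements. -/
theorem AddSubgroup.relIndex_eq_of_forall_iff {V' : Type*} [AddCommGroup V']
    {H G : AddSubgroup V} {H' G' : AddSubgroup V'}
    (h : ∀ n : ℕ, (∃ z : Fin n → V, (∀ i, z i ∈ G) ∧ ∀ i j, i ≠ j → z i - z j ∉ H) ↔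
      ∃ z : Fin n → V', (∀ i, z i ∈ G') ∧ ∀ i j, i ≠ j → z i - z j ∉ H') :
    H.relIndex G = H'.relIndex G' := by
  simp_rw [← AddSubgroup.natCast_le_card_quotient_iff] at h
  exact congrArg ENat.toNat (ENat.eq_of_forall_natCast_le_iff h)

/-- A set which is invariant under a closed subgroup `C`, and contained in a subgroup in which `C`
has finite index, is closed. -/
theorem isClosed_of_relIndex_ne_zero [TopologicalSpace W] [IsTopologicalAddGroup W]
    {C K : AddSubgroup W} (hC : IsClosed (C : Set W)) (h : C.relIndex K ≠ 0) {Y : Set W}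
    (hY : Y ⊆ K) (hYC : ∀ a ∈ Y, ∀ c ∈ C, a + c ∈ Y) : IsClosed Y := by
  obtain ⟨s, -, hs⟩ := AddSubgroup.exists_finset_cover_of_relIndex_ne_zero h
  have : Y = ⋃ t ∈ {t ∈ (s : Set W) | t ∈ Y}, (fun w => w - t) ⁻¹' (C : Set W) := by
    ext a
    simp only [Set.mem_ofPred_eq, Set.mem_iUnion, Set.mem_preimage, SetLike.mem_coe, exists_prop]
    constructor
    · intro ha
      obtain ⟨t, ht, hat⟩ := hs a (hY ha)
      exact ⟨t, ⟨ht, by simpa using hYC a ha _ (C.neg_mem hat)⟩, hat⟩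
    · rintro ⟨t, ⟨-, ht⟩, hat⟩
      simpa using hYC t ht _ hat
  rw [this]
  exact Set.Finite.isClosed_biUnion (s.finite_toSet.subset fun t ht => ht.1)
    fun t _ => hC.preimage (by fun_prop)

/-- If finitely many cosets cover a Bohr-type neighbourhood of `0` in `G`, the preimage of a
neighbourhood of `0` in a compact group, then one of the subgroups has finite index in `G`. Indeed
finitely many translates of the neighbourhood cover `G`, so that Neumann's lemma on coverings by
finitely many cosets applies. -/
theorem exists_relIndex_ne_zero_of_cover [TopologicalSpace W] [IsTopologicalAddGroup W]
    [CompactSpace W] (F : V →+ W) (G : AddSubgroup V) {U : Set W} (hU : U ∈ nhds 0)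
    {J : Type*} [Finite J] (H : J → AddSubgroup V) (q : J → V)
    (hcov : ∀ h ∈ G, F h ∈ U → ∃ j, h - q j ∈ H j) : ∃ j, (H j).relIndex G ≠ 0 := by
  classical
  have := Fintype.ofFinite J
  -- finitely many translates of the neighbourhood cover `G`
  obtain ⟨s, hs⟩ : ∃ s : Finset G, ∀ g : G, ∃ t ∈ s, F (g - t : V) ∈ U := by
    have hK : IsCompact (closure (F '' (G : Set V))) := isClosed_closure.isCompact
    obtain ⟨s, hs⟩ := hK.elim_finite_subcover (fun t : G => (fun w => w - F t) ⁻¹' interior U)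
      (fun t => isOpen_interior.preimage (by fun_prop)) (by
        intro a ha
        have hO : (fun w => a - w) ⁻¹' interior U ∈ nhds a :=
          (isOpen_interior.preimage (by fun_prop)).mem_nhds (by
            simpa using mem_interior_iff_mem_nhds.2 hU)
        obtain ⟨b, hb, ⟨t, ht, rfl⟩⟩ := mem_closure_iff_nhds.1 ha _ hO
        exact Set.mem_iUnion.2 ⟨⟨t, ht⟩, hb⟩)
    refine ⟨s, fun g => ?_⟩
    have := hs (subset_closure (Set.mem_image_of_mem F g.2))
    simp only [Set.mem_iUnion] at this
    obtain ⟨t, ht, h⟩ := this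
    exact ⟨t, ht, by rw [map_sub]; exact interior_subset h⟩
  by_contra! hzero
  -- a coset that misses `G` is represented by an arbitrary element of `G`
  have hq : ∀ j, ∃ g : G, ∀ h ∈ G, h - q j ∈ H j → h - g ∈ H j := by
    intro j
    by_cases h : ∃ g ∈ G, g - q j ∈ H j
    · obtain ⟨g, hg, hgq⟩ := h
      exact ⟨⟨g, hg⟩, fun h _ hh => by simpa using (H j).sub_mem hh hgq⟩
    · push Not at h
      exact ⟨0, fun g hg hh => absurd hh (h g hg)⟩
  choose r hr using hq
  obtain ⟨k, -, hk⟩ := AddSubgroup.exists_finiteIndex_of_leftCoset_cover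
    (H := fun k : G × J => (H k.2).addSubgroupOf G) (g := fun k => k.1 + r k.2)
    (s := s ×ˢ Finset.univ) (by
      refine Set.eq_univ_of_forall fun g => ?_
      obtain ⟨t, ht, hgt⟩ := hs g
      obtain ⟨j, hj⟩ := hcov _ (g - t).2 hgt
      simp only [Set.mem_iUnion]
      refine ⟨(t, j), by simpa using ht, ?_⟩
      rw [mem_leftAddCoset_iff, SetLike.mem_coe, AddSubgroup.mem_addSubgroupOf]
      have := hr j _ (g - t).2 hj
      convert this using 1
      simp; abel)
  exact hk.index_ne_zero (hzero k.2)

/-- The number of cosets of `H` that meet a coset of `L`. -/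
theorem ncard_image_mk_coset {H L : AddSubgroup V} (z₀ : V) :
    ((QuotientAddGroup.mk : V → V ⧸ H) '' {z | z - z₀ ∈ L}).ncard = H.relIndex L := by
  have h1 : (QuotientAddGroup.mk : V → V ⧸ H) '' {z | z - z₀ ∈ L} =
      (fun q => (z₀ : V ⧸ H) + q) '' (L.map (QuotientAddGroup.mk' H) : Set (V ⧸ H)) := by
    ext q
    constructor
    · rintro ⟨z, hz, rfl⟩
      exact ⟨_, ⟨z - z₀, hz, rfl⟩, by
        simp only [QuotientAddGroup.mk'_apply, ← QuotientAddGroup.mk_add]; congr 1; abel⟩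
    · rintro ⟨-, ⟨z, hz, rfl⟩, rfl⟩
      exact ⟨z₀ + z, by simpa using hz, by simp⟩
  rw [h1, Set.ncard_image_of_injective _ (add_right_injective _)]
  have := AddSubgroup.relIndex_ker L (QuotientAddGroup.mk' H)
  rw [QuotientAddGroup.ker_mk'] at this
  rw [this]
  rfl

/-- Counting the cosets of `H` in `X` that avoid the sets `B j` and contain a point on which `F` is
congruent to `d` modulo `QH`, where `X` and the `B j` are cosets of subgroups containing `H`. By
inclusion-exclusion, their number is determined by the truth values of `d - F (p S) ∈ Q S`, where
`p S` is a point of `X ∩ ⋂ j ∈ S, B j`, and `S` ranges over the family `𝒥` of index sets for which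
this intersection is nonempty. -/
theorem exists_avoiding_iff_sum_pos {J : Type*} [Fintype J] [DecidableEq J] (F : V →+ W)
    {H : AddSubgroup V} {QH : AddSubgroup W}
    {Hs : Finset J → AddSubgroup V} (hH : ∀ S, H ≤ Hs S) (hfin : H.relIndex (Hs ∅) ≠ 0)
    {Q : Finset J → AddSubgroup W} (hQ : ∀ S, Q S = QH ⊔ (Hs S).map F)
    {X : Set V} {B : J → Set V} (𝒥 : Finset (Finset J)) (p : Finset J → V)
    (hmem : ∀ S ∈ 𝒥, ∀ z, (z ∈ X ∧ ∀ j ∈ S, z ∈ B j) ↔ z - p S ∈ Hs S)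
    (hnot : ∀ S ∉ 𝒥, ∀ z ∈ X, ∃ j ∈ S, z ∉ B j) (d : W)
    {T : Finset (Finset J)} (hT : ∀ S, S ∈ T ↔ S ∈ 𝒥 ∧ d - F (p S) ∈ Q S) :
    (∃ z ∈ X, d - F z ∈ QH ∧ ∀ j, z ∉ B j) ↔
      0 < ∑ S ∈ T, (-1 : ℤ) ^ S.card * (H.relIndex (Hs S ⊓ QH.comap F) : ℤ) := by
  classical
  let π : V → V ⧸ H := QuotientAddGroup.mk
  have hπ : ∀ a b, π a = π b ↔ b - a ∈ H := fun a b => by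
    simp only [π, QuotientAddGroup.eq, neg_add_eq_sub]
  -- the intersections are invariant under `H`
  have hinv : ∀ S : Finset J, ∀ a b, π a = π b → a ∈ X → (∀ j ∈ S, a ∈ B j) →
      b ∈ X ∧ ∀ j ∈ S, b ∈ B j := by
    intro S a b hab ha haS
    by_cases hS : S ∈ 𝒥
    · rw [hmem S hS]
      have := (Hs S).add_mem ((hmem S hS a).1 ⟨ha, haS⟩) (hH S ((hπ a b).1 hab))
      convert this using 1
      abel
    · obtain ⟨j, hj, hj'⟩ := hnot S hS a ha
      exact absurd (haS j hj) hj'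
  let Y : Set V := {z | z ∈ X ∧ d - F z ∈ QH}
  have hYfin : (π '' Y).Finite := by
    by_cases h0 : ∅ ∈ 𝒥
    · have : (π '' {z | z - p ∅ ∈ Hs ∅}).Finite := by
        apply Set.finite_of_ncard_ne_zero
        rw [ncard_image_mk_coset]
        exact hfin
      refine this.subset (Set.image_mono fun z hz => ?_)
      exact (hmem ∅ h0 z).1 ⟨hz.1, by simp⟩
    · have : Y = ∅ := by
        refine Set.eq_empty_of_forall_notMem fun z hz => ?_
        obtain ⟨j, hj, -⟩ := hnot ∅ h0 z hz.1
        simp at hj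
      simp [this]
  have := hYfin.fintype
  let A : J → Finset (π '' Y) := fun j => Finset.univ.filter fun q => q.1 ∈ π '' (X ∩ B j)
  have hA : ∀ (z : V) (hz : z ∈ Y) j, (⟨π z, z, hz, rfl⟩ : π '' Y) ∈ A j ↔ z ∈ B j := by
    intro z hz j
    simp only [A, Finset.mem_filter, Finset.mem_univ, true_and]
    constructor
    · rintro ⟨a, ⟨ha, haB⟩, h⟩
      exact (hinv {j} a z h ha (by simpa using haB)).2 j (by simp)
    · intro h
      exact ⟨z, ⟨hz.1, h⟩, rfl⟩
  have hcard : ∀ S : Finset J, ((S.inf A).card : ℤ) =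
      if S ∈ T then (H.relIndex (Hs S ⊓ QH.comap F) : ℤ) else 0 := by
    intro S
    have h1 : (S.inf A).card = (π '' {z | z ∈ Y ∧ ∀ j ∈ S, z ∈ B j}).ncard := by
      rw [← Set.ncard_coe_finset, ← Set.ncard_image_of_injective _ Subtype.val_injective]
      congr 1
      ext q
      constructor
      · rintro ⟨⟨-, z, hz, rfl⟩, hq, rfl⟩
        refine ⟨z, ⟨hz, fun j hj => (hA z hz j).1 ?_⟩, rfl⟩
        exact Finset.mem_inf.1 hq j hj
      · rintro ⟨z, ⟨hz, hzS⟩, rfl⟩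
        exact ⟨⟨π z, z, hz, rfl⟩, Finset.mem_inf.2 fun j hj => (hA z hz j).2 (hzS j hj), rfl⟩
    rw [h1]
    by_cases hS : S ∈ 𝒥
    · by_cases hd : d - F (p S) ∈ Q S
      · rw [if_pos ((hT S).2 ⟨hS, hd⟩)]
        rw [hQ] at hd
        obtain ⟨q, hq, -, ⟨h, hh, rfl⟩, hqh⟩ := AddSubgroup.mem_sup.1 hd
        rw [← ncard_image_mk_coset (H := H) (p S + h)]
        refine congrArg (fun s => ((Set.ncard (π '' s) : ℕ) : ℤ)) (Set.ext fun z => ?_)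
        have e1 : z - p S = (z - (p S + h)) + h := by abel
        have e2 : d - F z = q - F (z - (p S + h)) := by
          have : d = q + F h + F (p S) := by rw [hqh]; abel
          rw [this]; simp only [map_sub, map_add]; abel
        have : (z ∈ X ∧ ∀ j ∈ S, z ∈ B j) ↔ z - (p S + h) ∈ Hs S := by
          rw [hmem S hS, e1]
          exact AddSubgroup.add_mem_cancel_right _ hh
        have h2 : d - F z ∈ QH ↔ F (z - (p S + h)) ∈ QH := by
          rw [e2, sub_eq_add_neg, AddSubgroup.add_mem_cancel_left _ hq, neg_mem_iff]
        simp only [Set.mem_ofPred_eq, Y, AddSubgroup.mem_inf, AddSubgroup.mem_comap, ← this, ← h2]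
        tauto
      · rw [if_neg fun h => hd ((hT S).1 h).2]
        have : {z | z ∈ Y ∧ ∀ j ∈ S, z ∈ B j} = ∅ := by
          refine Set.eq_empty_of_forall_notMem fun z hz => hd ?_
          have h3 := (hmem S hS z).1 ⟨hz.1.1, hz.2⟩
          rw [hQ]
          refine AddSubgroup.mem_sup.2 ⟨_, hz.1.2, _, ⟨_, h3, rfl⟩, ?_⟩
          simp
        simp [this]
    · rw [if_neg fun h => hS ((hT S).1 h).1]
      have : {z | z ∈ Y ∧ ∀ j ∈ S, z ∈ B j} = ∅ := by
        refine Set.eq_empty_of_forall_notMem fun z hz => ?_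
        obtain ⟨j, hj, hj'⟩ := hnot S hS z hz.1.1
        exact hj' (hz.2 j hj)
      simp [this]
  -- `A j` is the set of cosets meeting `Y` that lie in `B j`; a coset avoiding all `B j` is an
  -- element of the intersection of the complements of the `A j`
  have hsum := Finset.inclusion_exclusion_card_inf_compl Finset.univ A
  simp only [hcard, Finset.powerset_univ, mul_ite, mul_zero, Finset.sum_ite_mem,
    Finset.univ_inter] at hsum
  rw [← hsum, Nat.cast_pos, Finset.card_pos]
  constructor
  · rintro ⟨z, hzX, hzd, hz⟩
    refine ⟨⟨π z, z, ⟨hzX, hzd⟩, rfl⟩, Finset.mem_inf.2 fun j _ => ?_⟩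
    rw [Finset.mem_compl, hA z ⟨hzX, hzd⟩]
    exact hz j
  · rintro ⟨⟨-, z, hz, rfl⟩, hq⟩
    refine ⟨z, hz.1, hz.2, fun j hj => ?_⟩
    have := Finset.mem_inf.1 hq j (Finset.mem_univ j)
    rw [Finset.mem_compl, hA z hz] at this
    exact this hj

theorem comp_elim_add {ι κ : Type*} (F : V →+ W) (a : ι → V) (p q : κ → V) :
    F ∘ Sum.elim a (p + q) = F ∘ Sum.elim a p + Sum.elim (0 : ι → W) (F ∘ q) := by
  ext (i | i) <;> simp

end Groups

/-! ### Terms and positive primitive formulas -/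

section Terms

open FirstOrder Language

variable {S : ℕ → Type v} {ι ι' : Type} {B : Type x} [AddCommGroup B] {B' : Type y}
  [AddCommGroup B']

/-- The homomorphism `B^ι → B` defined by a term in the language of abelian structures. -/
def termHom (B : Type x) [AddCommGroup B] : (abelianLanguage S).Term ι → (ι → B) →+ B
  | .var i => Pi.evalAddMonoidHom (fun _ => B) i
  | .func AbelianFunctions.zero _ => 0
  | .func AbelianFunctions.neg ts => -termHom B (ts 0)
  | .func AbelianFunctions.add ts => termHom B (ts 0) + termHom B (ts 1)

theorem realize_eq_termHom (P : ∀ n, S n → AddSubgroup (Fin n → B))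
    (t : (abelianLanguage S).Term ι) (a : ι → B) :
    @Term.realize _ B (abelianStructure P) _ a t = termHom B t a := by
  induction t with
  | var i => rfl
  | func F ts ih =>
    cases F with
    | zero => rfl
    | neg => exact congrArg Neg.neg (ih 0)
    | add => exact congrArg₂ (· + ·) (ih 0) (ih 1)

theorem termHom_comp (g : B →+ B') (t : (abelianLanguage S).Term ι) (a : ι → B) :
    g (termHom B t a) = termHom B' t (g ∘ a) := by
  induction t with
  | var i => rfl
  | func F ts ih =>
    cases F with
    | zero => exact map_zero g
    | neg => simp only [termHom, AddMonoidHom.neg_apply, map_neg, ih]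
    | add => simp only [termHom, AddMonoidHom.add_apply, map_add, ih]

theorem continuous_termHom [TopologicalSpace B] [IsTopologicalAddGroup B]
    (t : (abelianLanguage S).Term ι) : Continuous (termHom B t) := by
  induction t with
  | var i => exact continuous_apply i
  | func F ts ih =>
    cases F with
    | zero => exact continuous_const
    | neg => exact (ih 0).neg
    | add => exact (ih 0).add (ih 1)

theorem termHom_subst (t : (abelianLanguage S).Term ι) (σ : ι → (abelianLanguage S).Term ι')
    (a : ι' → B) : termHom B (t.subst σ) a = termHom B t fun i => termHom B (σ i) a := by
  have := @Term.realize_subst _ B (abelianStructure fun _ _ => ⊤) _ _ t σ a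
  simpa only [realize_eq_termHom] using this

theorem termHom_relabel (t : (abelianLanguage S).Term ι) (e : ι → ι')
    (a : ι' → B) : termHom B (t.relabel e) a = termHom B t (a ∘ e) := by
  have := @Term.realize_relabel _ B (abelianStructure fun _ _ => ⊤) _ _ t e a
  simpa only [realize_eq_termHom] using this

/-- Atomic formulas in the language of abelian structures, in the variables `ι`. -/
inductive AbAtom (S : ℕ → Type v) (ι : Type) : Type v
  | eq (t₁ t₂ : (abelianLanguage S).Term ι) : AbAtom S ι
  | rel {n : ℕ} (R : S n) (ts : Fin n → (abelianLanguage S).Term ι) : AbAtom S ι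

namespace AbAtom

/-- The subgroup of solutions of an atomic formula. -/
def sol (P : ∀ n, S n → AddSubgroup (Fin n → B)) : AbAtom S ι → AddSubgroup (ι → B)
  | eq t₁ t₂ => (termHom B t₁).eqLocus (termHom B t₂)
  | rel R ts => (P _ R).comap (AddMonoidHom.mk' (fun a i => termHom B (ts i) a) fun a b => by
      ext i; exact map_add _ _ _)

/-- Substitution of terms in an atomic formula. -/
def subst (σ : ι → (abelianLanguage S).Term ι') : AbAtom S ι → AbAtom S ι'
  | eq t₁ t₂ => eq (t₁.subst σ) (t₂.subst σ)
  | rel R ts => rel R fun i => (ts i).subst σ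

theorem mem_sol_subst (P : ∀ n, S n → AddSubgroup (Fin n → B)) (φ : AbAtom S ι)
    (σ : ι → (abelianLanguage S).Term ι') (a : ι' → B) :
    a ∈ (φ.subst σ).sol P ↔ (fun i => termHom B (σ i) a) ∈ φ.sol P := by
  cases φ with
  | eq t₁ t₂ =>
    change termHom B _ a = termHom B _ a ↔ termHom B t₁ _ = termHom B t₂ _
    rw [termHom_subst, termHom_subst]
  | rel R ts =>
    change (fun i => termHom B ((ts i).subst σ) a) ∈ P _ R ↔ (fun i => termHom B (ts i) _) ∈ P _ R
    simp only [termHom_subst]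

/-- An atomic formula in free variables `ι` and bound variables `Fin k`, as a first order
formula. -/
def toBounded {k : ℕ} : AbAtom S (ι ⊕ Fin k) → (abelianLanguage S).BoundedFormula ι k
  | eq t₁ t₂ => t₁.bdEqual t₂
  | rel (n := n) R ts => Relations.boundedFormula (L := abelianLanguage S) (n := n) R ts

theorem isAtomic_toBounded {k : ℕ} (φ : AbAtom S (ι ⊕ Fin k)) : φ.toBounded.IsAtomic := by
  cases φ with
  | eq t₁ t₂ => exact .equal _ _
  | rel R ts => exact .rel _ _

theorem realize_toBounded (P : ∀ n, S n → AddSubgroup (Fin n → B)) {k : ℕ}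
    (φ : AbAtom S (ι ⊕ Fin k)) (a : ι → B) (b : Fin k → B) :
    @BoundedFormula.Realize _ B (abelianStructure P) _ _ φ.toBounded a b ↔
      Sum.elim a b ∈ φ.sol P := by
  let _ := abelianStructure P
  cases φ with
  | eq t₁ t₂ =>
    refine (BoundedFormula.realize_bdEqual _ _).trans ?_
    rw [realize_eq_termHom, realize_eq_termHom]
    rfl
  | rel R ts =>
    refine (BoundedFormula.realize_rel).trans ?_
    simp only [realize_eq_termHom]
    rfl

/-- The conjunction of a list of atomic formulas. The valid atomic formula `0 = 0` is added as a
conjunct, so that the conjunction is nonempty. -/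
def conj {k : ℕ} : List (AbAtom S (ι ⊕ Fin k)) → (abelianLanguage S).BoundedFormula ι k
  | [] => (AbAtom.eq (.func AbelianFunctions.zero Fin.elim0)
      (.func AbelianFunctions.zero Fin.elim0)).toBounded
  | φ :: l => φ.toBounded ⊓ conj l

theorem isAtomicConj_conj {k : ℕ} (l : List (AbAtom S (ι ⊕ Fin k))) : IsAtomicConj (conj l) := by
  induction l with
  | nil => exact .atomic (isAtomic_toBounded _)
  | cons φ l ih => exact .and (.atomic (isAtomic_toBounded _)) ih

theorem realize_conj (P : ∀ n, S n → AddSubgroup (Fin n → B)) {k : ℕ}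
    (l : List (AbAtom S (ι ⊕ Fin k))) (a : ι → B) (b : Fin k → B) :
    @BoundedFormula.Realize _ B (abelianStructure P) _ _ (conj l) a b ↔
      ∀ φ ∈ l, Sum.elim a b ∈ φ.sol P := by
  induction l with
  | nil =>
    rw [conj, realize_toBounded]
    simp [sol, AddMonoidHom.eqLocus]
  | cons φ l ih =>
    rw [conj, List.forall_mem_cons, ← ih, ← realize_toBounded]
    exact @BoundedFormula.realize_inf _ _ (abelianStructure P) _ _ _ _ _ _

end AbAtom

/-- A pp-formula in the free variables `ι`: finitely many atomic formulas in the variables `ι` and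
finitely many further variables `β`, which are existentially quantified. -/
structure PPFormula (S : ℕ → Type v) (ι : Type) where
  β : Type
  [finite : Finite β]
  atoms : List (AbAtom S (ι ⊕ β))

attribute [instance] PPFormula.finite

namespace PPFormula

/-- The subgroup of solutions of a pp-formula in an abelian structure. -/
def sol (P : ∀ n, S n → AddSubgroup (Fin n → B)) (ψ : PPFormula S ι) : AddSubgroup (ι → B) where
  carrier := {a | ∃ b : ψ.β → B, ∀ φ ∈ ψ.atoms, Sum.elim a b ∈ φ.sol P}
  zero_mem' := ⟨0, fun φ _ => by simp⟩
  add_mem' := by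
    rintro a a' ⟨b, hb⟩ ⟨b', hb'⟩
    exact ⟨b + b', fun φ hφ => by
      simpa [Sum.elim_add_add] using (φ.sol P).add_mem (hb φ hφ) (hb' φ hφ)⟩
  neg_mem' := by
    rintro a ⟨b, hb⟩
    exact ⟨-b, fun φ hφ => by
      simpa [Sum.elim_neg_neg] using (φ.sol P).neg_mem (hb φ hφ)⟩

variable {κ : Type} (P : ∀ n, S n → AddSubgroup (Fin n → B))

theorem mem_sol {ψ : PPFormula S ι} {a : ι → B} :
    a ∈ ψ.sol P ↔ ∃ b : ψ.β → B, ∀ φ ∈ ψ.atoms, Sum.elim a b ∈ φ.sol P := Iff.rfl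

/-- The pp-formula given by a single atomic formula. -/
def ofAtom (φ : AbAtom S ι) : PPFormula S ι := ⟨Empty, [φ.subst fun i => .var (Sum.inl i)]⟩

@[simp]
theorem mem_sol_ofAtom {φ : AbAtom S ι} {a : ι → B} : a ∈ (ofAtom φ).sol P ↔ a ∈ φ.sol P := by
  simp only [mem_sol, ofAtom, List.mem_singleton, forall_eq, AbAtom.mem_sol_subst]
  change (∃ _ : Empty → B, a ∈ φ.sol P) ↔ _
  exact exists_const _

/-- Substitution of terms in a pp-formula. -/
def subst (ψ : PPFormula S ι) (σ : ι → (abelianLanguage S).Term ι') : PPFormula S ι' :=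
  ⟨ψ.β, ψ.atoms.map fun φ => φ.subst
    (Sum.elim (fun i => (σ i).relabel Sum.inl) fun j => .var (Sum.inr j))⟩

@[simp]
theorem mem_sol_subst {ψ : PPFormula S ι} {σ : ι → (abelianLanguage S).Term ι'} {a : ι' → B} :
    a ∈ (ψ.subst σ).sol P ↔ (fun i => termHom B (σ i) a) ∈ ψ.sol P := by
  simp only [mem_sol, subst, List.mem_map, forall_exists_index, and_imp,
    forall_apply_eq_imp_iff₂, AbAtom.mem_sol_subst]
  refine exists_congr fun b => forall₂_congr fun φ _ => ?_
  rw [iff_iff_eq]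
  congr 1
  ext (i | j)
  · simp [termHom_relabel]
  · rfl

/-- Renaming of the free variables of a pp-formula. -/
def relabel (ψ : PPFormula S ι) (e : ι → ι') : PPFormula S ι' := ψ.subst fun i => .var (e i)

@[simp]
theorem mem_sol_relabel {ψ : PPFormula S ι} {e : ι → ι'} {a : ι' → B} :
    a ∈ (ψ.relabel e).sol P ↔ a ∘ e ∈ ψ.sol P := mem_sol_subst P

/-- The pp-formula `ψ(0, z)`. -/
def atZero (ψ : PPFormula S (ι ⊕ κ)) : PPFormula S κ :=
  ψ.subst (Sum.elim (fun _ => .func AbelianFunctions.zero Fin.elim0) fun j => .var j)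

@[simp]
theorem mem_sol_atZero {ψ : PPFormula S (ι ⊕ κ)} {a : κ → B} :
    a ∈ ψ.atZero.sol P ↔ Sum.elim (0 : ι → B) a ∈ ψ.sol P := by
  rw [atZero, mem_sol_subst, iff_iff_eq]
  congr 1
  ext (i | j) <;> rfl

/-- The conjunction of two pp-formulas. -/
def inf (ψ χ : PPFormula S ι) : PPFormula S ι :=
  ⟨ψ.β ⊕ χ.β, (ψ.atoms.map fun φ => φ.subst fun i => .var (Sum.map id Sum.inl i)) ++
    χ.atoms.map fun φ => φ.subst fun i => .var (Sum.map id Sum.inr i)⟩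

@[simp]
theorem mem_sol_inf {ψ χ : PPFormula S ι} {a : ι → B} :
    a ∈ (ψ.inf χ).sol P ↔ a ∈ ψ.sol P ∧ a ∈ χ.sol P := by
  have h1 : ∀ (b : ψ.β ⊕ χ.β → B), (fun i => termHom (S := S) B
      (.var (Sum.map id Sum.inl i : ι ⊕ (ψ.β ⊕ χ.β))) (Sum.elim a b)) =
      Sum.elim a (b ∘ Sum.inl) := by
    intro b; ext (i | j) <;> rfl
  have h2 : ∀ (b : ψ.β ⊕ χ.β → B), (fun i => termHom (S := S) B
      (.var (Sum.map id Sum.inr i : ι ⊕ (ψ.β ⊕ χ.β))) (Sum.elim a b)) =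
      Sum.elim a (b ∘ Sum.inr) := by
    intro b; ext (i | j) <;> rfl
  simp only [mem_sol, inf, List.mem_append, List.mem_map, or_imp, forall_and, forall_exists_index,
    and_imp, forall_apply_eq_imp_iff₂, AbAtom.mem_sol_subst, h1, h2]
  constructor
  · rintro ⟨b, hb1, hb2⟩
    exact ⟨⟨_, hb1⟩, ⟨_, hb2⟩⟩
  · rintro ⟨⟨b, hb⟩, ⟨c, hc⟩⟩
    exact ⟨Sum.elim b c, by simpa using hb, by simpa using hc⟩

/-- The valid pp-formula. -/
def top : PPFormula S ι := ⟨Empty, []⟩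

@[simp]
theorem mem_sol_top {a : ι → B} : a ∈ (top : PPFormula S ι).sol P :=
  (mem_sol P).2 ⟨Empty.elim, fun _ h => absurd h List.not_mem_nil⟩

/-- The conjunction of a list of pp-formulas. -/
def infList (l : List (PPFormula S ι)) : PPFormula S ι := l.foldr inf top

@[simp]
theorem mem_sol_infList {l : List (PPFormula S ι)} {a : ι → B} :
    a ∈ (infList l).sol P ↔ ∀ ψ ∈ l, a ∈ ψ.sol P := by
  induction l with
  | nil => simp [infList]
  | cons ψ l ih =>
    rw [infList, List.foldr_cons, mem_sol_inf]
    change _ ∧ _ ∈ (infList l).sol P ↔ _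
    rw [ih]
    simp

/-- Existential quantification of a pp-formula over finitely many variables. -/
def ex [Finite κ] (ψ : PPFormula S (ι ⊕ κ)) : PPFormula S ι :=
  ⟨κ ⊕ ψ.β, ψ.atoms.map fun φ => φ.subst fun i => .var (Equiv.sumAssoc _ _ _ i)⟩

theorem forall_atoms_ex [Finite κ] {ψ : PPFormula S (ι ⊕ κ)} {a : ι → B} {b : κ ⊕ ψ.β → B} :
    (∀ φ ∈ ψ.ex.atoms, Sum.elim a b ∈ φ.sol P) ↔ ∀ φ ∈ ψ.atoms,
      Sum.elim (Sum.elim a (b ∘ Sum.inl)) (b ∘ Sum.inr) ∈ φ.sol P := by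
  have h1 : (fun i => termHom (S := S) B
      (.var (Equiv.sumAssoc ι κ ψ.β i)) (Sum.elim a b)) =
      Sum.elim (Sum.elim a (b ∘ Sum.inl)) (b ∘ Sum.inr) := by
    ext ((i | j) | k) <;> rfl
  refine List.forall_mem_map.trans (forall₂_congr fun φ _ => ?_)
  exact (AbAtom.mem_sol_subst P φ _ _).trans (iff_of_eq (congrArg (· ∈ φ.sol P) h1))

@[simp]
theorem mem_sol_ex [Finite κ] {ψ : PPFormula S (ι ⊕ κ)} {a : ι → B} :
    a ∈ ψ.ex.sol P ↔ ∃ z : κ → B, Sum.elim a z ∈ ψ.sol P := by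
  constructor
  · rintro ⟨b, hb⟩
    exact ⟨_, _, (forall_atoms_ex P).1 hb⟩
  · rintro ⟨z, b, hb⟩
    exact ⟨Sum.elim z b, (forall_atoms_ex P).2 hb⟩

/-- The quantifier free part of a pp-formula, as a first order formula. The quantified variables are
enumerated by `Fin k`, where `k` is their number. -/
noncomputable def matrix (ψ : PPFormula S ι) :
    (abelianLanguage S).BoundedFormula ι (Nat.card ψ.β) :=
  AbAtom.conj (ψ.atoms.map fun φ => φ.subst fun i => .var (Sum.map id (Finite.equivFin ψ.β) i))

theorem realize_matrix {ψ : PPFormula S ι} {a : ι → B} {b : Fin (Nat.card ψ.β) → B} :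
    @BoundedFormula.Realize _ B (abelianStructure P) _ _ ψ.matrix a b ↔
      ∀ φ ∈ ψ.atoms, Sum.elim a (b ∘ Finite.equivFin ψ.β) ∈ φ.sol P := by
  have h1 : (fun i => termHom (S := S) B
      (.var (Sum.map id (Finite.equivFin ψ.β) i : ι ⊕ Fin (Nat.card ψ.β))) (Sum.elim a b)) =
      Sum.elim a (b ∘ Finite.equivFin ψ.β) := by
    ext (i | j) <;> rfl
  rw [matrix, AbAtom.realize_conj]
  simp only [List.mem_map, forall_exists_index,
    and_imp, forall_apply_eq_imp_iff₂, AbAtom.mem_sol_subst, h1]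

/-- A pp-formula as a first order formula. -/
noncomputable def toFormula (ψ : PPFormula S ι) : (abelianLanguage S).Formula ι := ψ.matrix.exs

theorem realize_toFormula {ψ : PPFormula S ι} {a : ι → B} :
    @Formula.Realize _ B (abelianStructure P) _ ψ.toFormula a ↔ a ∈ ψ.sol P := by
  let _ := abelianStructure P
  rw [toFormula, BoundedFormula.realize_exs, mem_sol]
  simp only [realize_matrix]
  constructor
  · rintro ⟨b, hb⟩
    exact ⟨_, hb⟩
  · rintro ⟨b, hb⟩
    exact ⟨b ∘ (Finite.equivFin ψ.β).symm, by simpa [Function.comp_assoc] using hb⟩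

theorem isPP_toFormula {m : ℕ} (ψ : PPFormula S (Fin m)) : IsPP ψ.toFormula :=
  ⟨_, _, AbAtom.isAtomicConj_conj _, rfl⟩

end PPFormula

end Terms

/-! ### Transfer of sentences to approximate models -/

section Transfer

open FirstOrder Language

variable {L : FirstOrder.Language.{u, v}} {C : Type w} [TopologicalSpace C]
  {M : CLStructure.{u, v, w, y} L C} {N : CLStructure.{u, v, w, x} L C}

namespace CLFormula

theorem realize_exs {α : Type*} : ∀ {n : ℕ} (φ : CLFormula L C α n) (a : α → M.carrier)
    (b : Fin 0 → M.carrier), φ.exs.Realize M a b ↔ ∃ c, φ.Realize M a c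
  | 0, φ, a, b => by
    have : ∀ c : Fin 0 → M.carrier, c = b := fun c => Subsingleton.elim _ _
    exact ⟨fun h => ⟨b, h⟩, fun ⟨c, h⟩ => this c ▸ h⟩
  | n + 1, φ, a, b => by
    rw [exs, realize_exs (ex φ)]
    constructor
    · rintro ⟨c, d, h⟩
      exact ⟨_, h⟩
    · rintro ⟨c, h⟩
      exact ⟨Fin.init c, c (Fin.last n), by rwa [Fin.snoc_init_self]⟩

theorem Approx.exs {α : Type*} : ∀ {n : ℕ} {φ φ' : CLFormula L C α n}, φ.Approx φ' →
    φ.exs.Approx φ'.exs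
  | 0, _, _, h => h
  | _ + 1, φ, φ', h => (Approx.exs (Approx.ex h) : φ.ex.exs.Approx φ'.ex.exs)

/-- Universal quantification over all variables indexed by `Fin n`. -/
def alls {α : Type*} : {n : ℕ} → CLFormula L C α n → CLFormula L C α 0
  | 0, φ => φ
  | _ + 1, φ => alls (all φ)

theorem realize_alls {α : Type*} : ∀ {n : ℕ} (φ : CLFormula L C α n) (a : α → M.carrier)
    (b : Fin 0 → M.carrier), φ.alls.Realize M a b ↔ ∀ c, φ.Realize M a c
  | 0, φ, a, b => by
    have : ∀ c : Fin 0 → M.carrier, c = b := fun c => Subsingleton.elim _ _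
    exact ⟨fun h c => this c ▸ h, fun h => h b⟩
  | n + 1, φ, a, b => by
    rw [alls, realize_alls (all φ)]
    constructor
    · intro h c
      have := h (Fin.init c) (c (Fin.last n))
      rwa [Fin.snoc_init_self] at this
    · intro h c d
      exact h _

theorem Approx.alls {α : Type*} : ∀ {n : ℕ} {φ φ' : CLFormula L C α n}, φ.Approx φ' →
    φ.alls.Approx φ'.alls
  | 0, _, _, h => h
  | _ + 1, φ, φ', h => (Approx.alls (Approx.all h) : φ.all.alls.Approx φ'.all.alls)

theorem realize_conj {α : Type*} {n : ℕ} {l : List (CLFormula L C α n)} {a : α → M.carrier}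
    {b : Fin n → M.carrier} : (conj l).Realize M a b ↔ ∀ φ ∈ l, φ.Realize M a b := by
  induction l with
  | nil => simp [conj, Realize]
  | cons φ l ih => simp [conj, Realize, ih]

theorem Realize.approx {α : Type*} {n : ℕ} {φ φ' : CLFormula L C α n} (h : φ.Approx φ') :
    ∀ {a : α → M.carrier} {b : Fin n → M.carrier}, φ.Realize M a b → φ'.Realize M a b := by
  induction h with
  | fo φ => exact id
  | mem h ts => exact fun hr => (ClosedNhd.of_closedApprox h).subset hr
  | and _ _ ih₁ ih₂ => exact fun hr => ⟨ih₁ hr.1, ih₂ hr.2⟩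
  | or _ _ ih₁ ih₂ => exact fun hr => hr.imp ih₁ ih₂
  | ex _ ih => exact fun ⟨c, hr⟩ => ⟨c, ih hr⟩
  | all _ ih => exact fun hr c => ih (hr c)

theorem Realize.approxRealize {α : Type*} {n : ℕ} {φ : CLFormula L C α n}
    {a : α → M.carrier} {b : Fin n → M.carrier} (h : φ.Realize M a b) : φ.ApproxRealize M a b :=
  fun _ h' => h.approx h'

theorem Approx.exists_between [CompactSpace C] [T2Space C] {α : Type*} {n : ℕ}
    {φ φ' : CLFormula L C α n} (h : φ.Approx φ') : ∃ ψ, φ.Approx ψ ∧ ψ.Approx φ' := by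
  induction h with
  | fo φ => exact ⟨_, .fo φ, .fo φ⟩
  | mem h ts =>
    obtain ⟨E, h1, h2⟩ := (ClosedNhd.of_closedApprox h).exists_between
    exact ⟨CLFormula.mem ⟨E, h1.2⟩ ts, .mem (ClosedNhd.closedApprox h1) ts,
      .mem (ClosedNhd.closedApprox (D := ⟨E, h1.2⟩) h2) ts⟩
  | and _ _ ih₁ ih₂ =>
    obtain ⟨⟨_, a, b⟩, ⟨_, c, d⟩⟩ := And.intro ih₁ ih₂
    exact ⟨_, .and a c, .and b d⟩
  | or _ _ ih₁ ih₂ =>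
    obtain ⟨⟨_, a, b⟩, ⟨_, c, d⟩⟩ := And.intro ih₁ ih₂
    exact ⟨_, .or a c, .or b d⟩
  | ex _ ih =>
    obtain ⟨_, a, b⟩ := ih
    exact ⟨_, .ex a, .ex b⟩
  | all _ ih =>
    obtain ⟨_, a, b⟩ := ih
    exact ⟨_, .all a, .all b⟩

end CLFormula

/-- A formula in the variables `ι`, rewritten as a formula in the variables `Fin n` along a map
`ι → Fin n`. -/
theorem realize_relabel_inr {ι : Type} (φ : L.Formula ι) {n : ℕ} (v : ι → Fin n) {K : Type*}
    [L.Structure K] (b : Fin n → K) :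
    (BoundedFormula.relabel (n := n) (Sum.inr ∘ v : ι → Empty ⊕ Fin n) φ).Realize Empty.elim b ↔
      φ.Realize (b ∘ v) := by
  rw [BoundedFormula.realize_relabel, Formula.Realize, iff_iff_eq]
  congr 1
  exact Subsingleton.elim _ _

/-- Predicates `R` on `M` and `R'` on `N` in the variables `ι` for which there are a CL-formula
without parameters that follows from `R` in `M` and an approximation to it that implies `R'` in
`N`. -/
def Transfers (M : CLStructure.{u, v, w, y} L C) (N : CLStructure.{u, v, w, x} L C) {ι : Type}
    (R : (ι → M.carrier) → Prop) (R' : (ι → N.carrier) → Prop) : Prop :=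
  ∀ (n : ℕ) (v : ι → Fin n), ∃ φ φ' : CLFormula L C Empty n, φ.Approx φ' ∧
    (∀ b, R (b ∘ v) → φ.Realize M Empty.elim b) ∧ (∀ b, φ'.Realize N Empty.elim b → R' (b ∘ v))

namespace Transfers

variable {ι : Type} {R R₁ R₂ : (ι → M.carrier) → Prop} {R' R₁' R₂' : (ι → N.carrier) → Prop}

theorem and (h₁ : Transfers M N R₁ R₁') (h₂ : Transfers M N R₂ R₂') :
    Transfers M N (fun a => R₁ a ∧ R₂ a) (fun a => R₁' a ∧ R₂' a) := by
  intro n v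
  obtain ⟨φ₁, φ₁', h11, h12, h13⟩ := h₁ n v
  obtain ⟨φ₂, φ₂', h21, h22, h23⟩ := h₂ n v
  exact ⟨_, _, .and h11 h21, fun b h => ⟨h12 b h.1, h22 b h.2⟩, fun b h => ⟨h13 b h.1, h23 b h.2⟩⟩

theorem or (h₁ : Transfers M N R₁ R₁') (h₂ : Transfers M N R₂ R₂') :
    Transfers M N (fun a => R₁ a ∨ R₂ a) (fun a => R₁' a ∨ R₂' a) := by
  intro n v
  obtain ⟨φ₁, φ₁', h11, h12, h13⟩ := h₁ n v
  obtain ⟨φ₂, φ₂', h21, h22, h23⟩ := h₂ n v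
  exact ⟨_, _, .or h11 h21, fun b h => h.imp (h12 b) (h22 b), fun b h => h.imp (h13 b) (h23 b)⟩

theorem formula (φ : L.Formula ι) :
    Transfers M N (fun a => φ.Realize a) (fun a => φ.Realize a) := by
  intro n v
  refine ⟨_, _, .fo (BoundedFormula.relabel (n := n) (Sum.inr ∘ v : ι → Empty ⊕ Fin n) φ),
    fun b hb => ?_, fun b hb => ?_⟩
  · exact (realize_relabel_inr φ v b).2 hb
  · exact (realize_relabel_inr φ v b).1 hb

theorem false : Transfers M N (ι := ι) (fun _ => False) (fun _ => False) := by
  intro n v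
  exact ⟨.fo ⊥, .fo ⊥, .fo _, fun b h => h.elim, fun b h => by simp [CLFormula.Realize] at h⟩

theorem forall_finite {J : Type*} [Finite J] {R : J → (ι → M.carrier) → Prop}
    {R' : J → (ι → N.carrier) → Prop} (h : ∀ j, Transfers M N (R j) (R' j)) :
    Transfers M N (fun a => ∀ j, R j a) (fun a => ∀ j, R' j a) := by
  intro n v
  have := Fintype.ofFinite J
  choose φ φ' h1 h2 h3 using fun j => h j n v
  have key : ∀ l : List J, (CLFormula.conj (l.map φ)).Approx (CLFormula.conj (l.map φ')) := by
    intro l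
    induction l with
    | nil => exact .fo _
    | cons j l ih => exact .and (h1 j) ih
  refine ⟨_, _, key Finset.univ.toList, fun b hb => ?_, fun b hb j => ?_⟩
  · simp only [CLFormula.realize_conj, List.mem_map, forall_exists_index, and_imp,
      forall_apply_eq_imp_iff₂]
    exact fun j _ => h2 j b (hb j)
  · simp only [CLFormula.realize_conj, List.mem_map, forall_exists_index, and_imp,
      forall_apply_eq_imp_iff₂] at hb
    exact h3 j b (hb j (by simp))

theorem mono {Q : (ι → M.carrier) → Prop} {Q' : (ι → N.carrier) → Prop} (h : Transfers M N R R')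
    (h₁ : ∀ a, Q a → R a) (h₂ : ∀ a, R' a → Q' a) : Transfers M N Q Q' := by
  intro n v
  obtain ⟨φ, φ', h3, h4, h5⟩ := h n v
  exact ⟨φ, φ', h3, fun b hb => h4 b (h₁ _ hb), fun b hb => h₂ _ (h5 b hb)⟩

theorem exists_finite {J : Type*} [Finite J] {R : J → (ι → M.carrier) → Prop}
    {R' : J → (ι → N.carrier) → Prop} (h : ∀ j, Transfers M N (R j) (R' j)) :
    Transfers M N (fun a => ∃ j, R j a) (fun a => ∃ j, R' j a) := by
  have := Fintype.ofFinite J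
  have key : ∀ l : List J, Transfers M N (fun a => ∃ j ∈ l, R j a) (fun a => ∃ j ∈ l, R' j a) := by
    intro l
    induction l with
    | nil => simpa using false
    | cons j l ih => simpa using (h j).or ih
  exact (key Finset.univ.toList).mono (fun a ⟨j, hj⟩ => ⟨j, by simp, hj⟩)
    (fun a ⟨j, _, hj⟩ => ⟨j, hj⟩)

theorem mem_terms {k : ℕ} {D D' : Set (Fin k → C)} (h : ClosedNhd D D')
    (ts : Fin k → L.Term ι) :
    Transfers M N (fun a => (fun i => M.toFun ((ts i).realize a)) ∈ D)
      (fun a => (fun i => N.toFun ((ts i).realize a)) ∈ D') := by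
  intro n v
  refine ⟨.mem ⟨D, h.1⟩ fun i => (ts i).relabel (Sum.inr ∘ v), .mem ⟨D', h.2⟩ _,
    .mem (ClosedNhd.closedApprox h) _, fun b hb => ?_, fun b hb => ?_⟩
  · simpa [CLFormula.Realize, ← Function.comp_assoc] using hb
  · simpa [CLFormula.Realize, ← Function.comp_assoc] using hb

theorem mem [Finite ι] {D D' : Set (ι → C)} (h : ClosedNhd D D') :
    Transfers M N (fun a => M.toFun ∘ a ∈ D) (fun a => N.toFun ∘ a ∈ D') := by
  let e := Finite.equivFin ι
  have := mem_terms (M := M) (N := N)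
    (h.preimage (g := fun c : Fin (Nat.card ι) → C => c ∘ e) (by fun_prop))
    (fun i => .var (e.symm i))
  refine this.mono (fun a ha => ?_) (fun a ha => ?_)
  · simpa [Function.comp_def] using ha
  · simpa [Function.comp_def] using ha

/-- Universal statements transfer to approximate models, up to approximation. -/
theorem realize_forall [Finite ι] (hN : N.IsApproxModel M.theory) (h : Transfers M N R R')
    (hR : ∀ a, R a) (a : ι → N.carrier) : R' a := by
  let e := Finite.equivFin ι
  obtain ⟨φ, φ', h1, h2, h3⟩ := h _ e
  have h4 : φ.alls ∈ M.theory :=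
    CLFormula.Realize.approxRealize ((CLFormula.realize_alls _ _ _).2 fun b => h2 b (hR _))
  have h5 := (CLFormula.realize_alls _ _ _).1 (hN _ h4 _ h1.alls) (a ∘ e.symm)
  simpa [Function.comp_assoc] using h3 _ h5

/-- Existential statements transfer to approximate models, up to approximation. -/
theorem realize_exists [Finite ι] (hN : N.IsApproxModel M.theory) (h : Transfers M N R R')
    (hR : ∃ a, R a) : ∃ a, R' a := by
  let e := Finite.equivFin ι
  obtain ⟨φ, φ', h1, h2, h3⟩ := h _ e
  obtain ⟨a, ha⟩ := hR
  have h4 : φ.exs ∈ M.theory :=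
    CLFormula.Realize.approxRealize ((CLFormula.realize_exs _ _ _).2
      ⟨a ∘ e.symm, h2 _ (by simpa [Function.comp_assoc] using ha)⟩)
  obtain ⟨b, hb⟩ := (CLFormula.realize_exs _ _ _).1 (hN _ h4 _ h1.exs)
  exact ⟨_, h3 b hb⟩

end Transfers

end Transfer

/-! ### Approximate models are abelian structures with a homomorphism -/

section Models

open FirstOrder Language

variable {S : ℕ → Type v} {A : Type y} [AddCommGroup A] {P : ∀ n, S n → AddSubgroup (Fin n → A)}
  {𝕋 : Type w} [AddCommGroup 𝕋] [TopologicalSpace 𝕋] [IsTopologicalAddGroup 𝕋]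
  [CompactSpace 𝕋] [T2Space 𝕋] {f : A →+ 𝕋}

/-- The term `s + t`. -/
def addTerm {ι : Type} (s t : (abelianLanguage S).Term ι) : (abelianLanguage S).Term ι :=
  .func (L := abelianLanguage S) AbelianFunctions.add ![s, t]

/-- The term `-t`. -/
def negTerm {ι : Type} (t : (abelianLanguage S).Term ι) : (abelianLanguage S).Term ι :=
  .func (L := abelianLanguage S) AbelianFunctions.neg ![t]

/-- The term `0`. -/
def zeroTerm {ι : Type} : (abelianLanguage S).Term ι :=
  .func (L := abelianLanguage S) AbelianFunctions.zero ![]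

/-- The axioms of abelian structures and the additivity of `f` are part of the theory, so that an
approximate model is given by an abelian structure and a homomorphism. -/
theorem exists_eq_abelianCLStructure {N : CLStructure.{0, v, w, x} (abelianLanguage S) 𝕋}
    (hN : N.IsApproxModel (abelianCLStructure P f).theory) :
    ∃ (_ : AddCommGroup N.carrier) (P' : ∀ n, S n → AddSubgroup (Fin n → N.carrier))
      (g : N.carrier →+ 𝕋), N = abelianCLStructure P' g := by
  have hform : ∀ {n : ℕ} (φ : (abelianLanguage S).Formula (Fin n)),
      (∀ a : Fin n → A, @Formula.Realize _ A (abelianStructure P) _ φ a) →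
      ∀ a : Fin n → N.carrier, φ.Realize a := fun φ h =>
    (Transfers.formula φ).realize_forall hN h
  have heq : ∀ {n : ℕ} (s t : (abelianLanguage S).Term (Fin n)),
      (∀ a : Fin n → A, termHom A s a = termHom A t a) →
      ∀ a : Fin n → N.carrier, s.realize a = t.realize a := by
    intro n s t h a
    refine Formula.realize_equal.1 (hform (s.equal t) (fun a => ?_) a)
    rw [@Formula.realize_equal _ _ (abelianStructure P), realize_eq_termHom, realize_eq_termHom]
    exact h a
  -- for a closed condition, truth of all approximations is truth of the condition itself
  have hmem : ∀ {n k : ℕ} (D : Set (Fin k → 𝕋)), IsClosed D →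
      ∀ (ts : Fin k → (abelianLanguage S).Term (Fin n)),
      (∀ a : Fin n → A, (fun i => f (termHom A (ts i) a)) ∈ D) →
      ∀ a : Fin n → N.carrier, (fun i => N.toFun ((ts i).realize a)) ∈ D := by
    intro n k D hD ts h a
    refine ClosedNhd.mem_of_forall hD fun D' hD' => ?_
    refine (Transfers.mem_terms hD' ts).realize_forall hN (fun a => ?_) a
    exact Set.mem_of_eq_of_mem
      (funext fun i => congrArg f (realize_eq_termHom P (ts i) a)) (h a)
  obtain ⟨B, str, F⟩ := N
  dsimp only at *
  let add : B → B → B := fun a b => str.funMap (n := 2) AbelianFunctions.add ![a, b]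
  let neg : B → B := fun a => str.funMap (n := 1) AbelianFunctions.neg ![a]
  let zero : B := str.funMap (n := 0) AbelianFunctions.zero ![]
  have hadd : ∀ {n : ℕ} (s t : (abelianLanguage S).Term (Fin n)) (a : Fin n → B),
      (addTerm s t).realize a = add (s.realize a) (t.realize a) := by
    intro n s t a
    refine congrArg (str.funMap (n := 2) AbelianFunctions.add) (funext fun i => ?_)
    fin_cases i <;> rfl
  have hneg : ∀ {n : ℕ} (t : (abelianLanguage S).Term (Fin n)) (a : Fin n → B),
      (negTerm t).realize a = neg (t.realize a) := by
    intro n t a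
    refine congrArg (str.funMap (n := 1) AbelianFunctions.neg) (funext fun i => ?_)
    fin_cases i; rfl
  have hzero : ∀ {n : ℕ} (a : Fin n → B), (zeroTerm (S := S)).realize a = zero := by
    intro n a
    exact congrArg (str.funMap (n := 0) AbelianFunctions.zero) (Subsingleton.elim _ _)
  have tadd : ∀ {n : ℕ} (s t : (abelianLanguage S).Term (Fin n)) (a : Fin n → A),
      termHom A (addTerm s t) a = termHom A s a + termHom A t a := fun _ _ _ => rfl
  have tneg : ∀ {n : ℕ} (t : (abelianLanguage S).Term (Fin n)) (a : Fin n → A),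
      termHom A (negTerm t) a = -termHom A t a := fun _ _ => rfl
  have tzero : ∀ {n : ℕ} (a : Fin n → A), termHom A (zeroTerm (S := S)) a = 0 := fun _ => rfl
  let _ : Add B := ⟨add⟩
  let _ : Neg B := ⟨neg⟩
  let _ : Zero B := ⟨zero⟩
  let grp : AddCommGroup B :=
    { AddGroup.ofLeftAxioms (G := B)
        (fun a b c => by
          have := heq (addTerm (addTerm (.var 0) (.var 1)) (.var 2))
            (addTerm (.var 0) (addTerm (.var 1) (.var 2))) (fun a => by simp only [tadd, add_assoc])
            ![a, b, c]
          simp only [hadd] at this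
          exact this)
        (fun a => by
          have := heq (addTerm zeroTerm (.var 0)) (.var 0)
            (fun a => by simp only [tadd, tzero, zero_add]) ![a]
          simp only [hadd, hzero] at this
          exact this)
        (fun a => by
          have := heq (addTerm (negTerm (.var 0)) (.var 0)) zeroTerm
            (fun a => by simp only [tadd, tneg, tzero, neg_add_cancel]) ![a]
          simp only [hadd, hneg, hzero] at this
          exact this) with
      add_comm := fun a b => by
        have := heq (addTerm (.var 0) (.var 1)) (addTerm (.var 1) (.var 0))
          (fun a => by simp only [tadd, add_comm]) ![a, b]
        simp only [hadd] at this
        exact this }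
  -- closure of the relations under the group operations
  have hrel : ∀ {n : ℕ} (R : S n), ∃ H : AddSubgroup (Fin n → B),
      ∀ a, a ∈ H ↔ str.RelMap (n := n) R a := by
    intro n R
    have hR : ∀ {k : ℕ} (ts : Fin n → (abelianLanguage S).Term (Fin k)) (a : Fin k → B),
        (Relations.formula (L := abelianLanguage S) (n := n) R ts).Realize a ↔
          str.RelMap (n := n) R fun i => (ts i).realize a := fun ts a => Formula.realize_rel
    have hRA : ∀ {k : ℕ} (ts : Fin n → (abelianLanguage S).Term (Fin k)) (a : Fin k → A),
        @Formula.Realize _ A (abelianStructure P) _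
          (Relations.formula (L := abelianLanguage S) (n := n) R ts) a ↔
          (fun i => termHom A (ts i) a) ∈ P n R := by
      intro k ts a
      refine (@Formula.realize_rel _ _ (abelianStructure P) _ _ _ _ _).trans
        (iff_of_eq (congrArg (· ∈ P n R) (funext fun i => realize_eq_termHom P (ts i) a)))
    let l : Fin n → (abelianLanguage S).Term (Fin (n + n)) := fun i => .var (Fin.castAdd n i)
    let r : Fin n → (abelianLanguage S).Term (Fin (n + n)) := fun i => .var (Fin.natAdd n i)
    have hl : ∀ a b : Fin n → B, (fun i => (l i).realize (Fin.append a b)) = a := fun a b => by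
      ext i; exact Fin.append_left a b i
    have hr : ∀ a b : Fin n → B, (fun i => (r i).realize (Fin.append a b)) = b := fun a b => by
      ext i; exact Fin.append_right a b i
    refine ⟨⟨⟨⟨{a | str.RelMap (n := n) R a}, ?_⟩, ?_⟩, ?_⟩, fun a => Iff.rfl⟩
    · intro a b ha hb
      have := hform ((Relations.formula (L := abelianLanguage S) (n := n) R l).imp
        ((Relations.formula (L := abelianLanguage S) (n := n) R r).imp
          (Relations.formula (L := abelianLanguage S) (n := n) R fun i => addTerm (l i) (r i))))
        (fun a => by
          rw [@Formula.realize_imp _ _ (abelianStructure P),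
            @Formula.realize_imp _ _ (abelianStructure P), hRA, hRA, hRA]
          exact fun h1 h2 => (P n R).add_mem h1 h2) (Fin.append a b)
      rw [Formula.realize_imp, Formula.realize_imp, hR, hR, hR, hl, hr] at this
      simp only [hadd] at this
      have h2 := this ha hb
      have h3 : (fun i => add ((l i).realize (Fin.append a b)) ((r i).realize (Fin.append a b))) =
          a + b := by
        ext i; exact congrArg₂ add (congrFun (hl a b) i) (congrFun (hr a b) i)
      rwa [h3] at h2
    · have := hform (n := 0) (Relations.formula (L := abelianLanguage S) (n := n) R
        fun i => zeroTerm) (fun a => by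
          rw [hRA]
          exact (P n R).zero_mem) Fin.elim0
      rw [hR] at this
      simp only [hzero] at this
      exact this
    · intro a ha
      let t : Fin n → (abelianLanguage S).Term (Fin n) := fun i => .var i
      have := hform ((Relations.formula (L := abelianLanguage S) (n := n) R t).imp
          (Relations.formula (L := abelianLanguage S) (n := n) R fun i => negTerm (t i)))
        (fun a => by
          rw [@Formula.realize_imp _ _ (abelianStructure P), hRA, hRA]
          exact fun h1 => (P n R).neg_mem h1) a
      rw [Formula.realize_imp, hR, hR] at this
      simp only [hneg] at this
      exact this ha
  choose P' hP' using @hrel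
  have hF : ∀ a b : B, F (a + b) = F a + F b := by
    intro a b
    have := hmem {c : Fin 3 → 𝕋 | c 2 = c 0 + c 1}
      (isClosed_eq (by fun_prop) (by fun_prop)) ![.var 0, .var 1, addTerm (.var 0) (.var 1)]
      (fun a => by
        simp only [Set.mem_ofPred_eq]
        exact map_add f (a 0) (a 1)) ![a, b]
    have h : F ((addTerm (.var 0) (.var 1) : (abelianLanguage S).Term (Fin 2)).realize ![a, b]) =
      F a + F b := this
    rwa [hadd] at h
  refine ⟨grp, @P', AddMonoidHom.mk' F hF, ?_⟩
  have hstr : str = @abelianStructure S B grp @P' := by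
    refine Structure.ext ?_ ?_
    · funext n G a
      cases G with
      | zero => exact congrArg (str.funMap (n := 0) AbelianFunctions.zero) (Subsingleton.elim _ _)
      | neg =>
        refine congrArg (str.funMap (n := 1) AbelianFunctions.neg) (funext fun i => ?_)
        fin_cases i; rfl
      | add =>
        refine congrArg (str.funMap (n := 2) AbelianFunctions.add) (funext fun i => ?_)
        fin_cases i <;> rfl
    · funext n R a
      exact propext (hP' R a).symm
  rw [hstr]
  rfl

end Models

/-! ### Invariants of the approximate models -/

section Interpolation

open FirstOrder Language

variable {S : ℕ → Type v} {A : Type y} [AddCommGroup A] {P : ∀ n, S n → AddSubgroup (Fin n → A)}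
  {𝕋 : Type w} [AddCommGroup 𝕋] [TopologicalSpace 𝕋]

/-- The pp-formula stating that the difference of two subtuples satisfies a pp-formula. -/
def PPFormula.diff {ι κ : Type} (φ : PPFormula S κ) (e e' : κ → ι) : PPFormula S ι :=
  φ.subst fun k => addTerm (.var (e k)) (negTerm (.var (e' k)))

theorem PPFormula.mem_sol_diff {ι κ : Type} {φ : PPFormula S κ} {e e' : κ → ι} {a : ι → A} :
    a ∈ (φ.diff e e').sol P ↔ a ∘ e - a ∘ e' ∈ φ.sol P := by
  rw [PPFormula.diff, PPFormula.mem_sol_subst, iff_iff_eq]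
  congr 1
  ext k
  exact (sub_eq_add_neg _ _).symm

/-- The closure in `𝕋^κ` of the set of values of `f` on the solutions of a pp-formula. -/
def limitGroup [IsTopologicalAddGroup 𝕋] (P : ∀ n, S n → AddSubgroup (Fin n → A)) (f : A →+ 𝕋)
    {κ : Type} (ψ : PPFormula S κ) : AddSubgroup (κ → 𝕋) :=
  ((ψ.sol P).map (f.compLeft κ)).topologicalClosure

theorem isClosed_limitGroup [IsTopologicalAddGroup 𝕋] {f : A →+ 𝕋} {κ : Type}
    (ψ : PPFormula S κ) : IsClosed (limitGroup P f ψ : Set (κ → 𝕋)) :=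
  AddSubgroup.isClosed_topologicalClosure _

theorem comp_mem_limitGroup [IsTopologicalAddGroup 𝕋] {f : A →+ 𝕋} {κ : Type}
    {ψ : PPFormula S κ} {a : κ → A} (h : a ∈ ψ.sol P) : f ∘ a ∈ limitGroup P f ψ :=
  AddSubgroup.le_topologicalClosure _ ⟨a, h, rfl⟩

/-- Approximate models of the theory of `(A, f, 𝕋)`, presented as an abelian structure with a
homomorphism to `𝕋`. -/
structure AbelianModel (P : ∀ n, S n → AddSubgroup (Fin n → A)) (f : A →+ 𝕋) :
    Type (max v w (x + 1) y) where
  carrier : Type x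
  [addCommGroup : AddCommGroup carrier]
  rel : ∀ n, S n → AddSubgroup (Fin n → carrier)
  hom : carrier →+ 𝕋
  isApproxModel : (abelianCLStructure rel hom).IsApproxModel (abelianCLStructure P f).theory

attribute [instance] AbelianModel.addCommGroup

theorem transfers_sol {B : Type x} [AddCommGroup B] {P' : ∀ n, S n → AddSubgroup (Fin n → B)}
    {f : A →+ 𝕋} {g : B →+ 𝕋} {ι : Type} (ψ : PPFormula S ι) :
    Transfers (abelianCLStructure P f) (abelianCLStructure P' g)
      (fun a : ι → A => a ∈ ψ.sol P) (fun a : ι → B => a ∈ ψ.sol P') :=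
  (Transfers.formula ψ.toFormula).mono
    (fun _ => (PPFormula.realize_toFormula P).2) (fun _ => (PPFormula.realize_toFormula P').1)

theorem transfers_not_sol {B : Type x} [AddCommGroup B]
    {P' : ∀ n, S n → AddSubgroup (Fin n → B)} {f : A →+ 𝕋} {g : B →+ 𝕋} {ι : Type}
    (ψ : PPFormula S ι) :
    Transfers (abelianCLStructure P f) (abelianCLStructure P' g)
      (fun a : ι → A => a ∉ ψ.sol P) (fun a : ι → B => a ∉ ψ.sol P') :=
  (Transfers.formula ψ.toFormula.not).mono
    (fun _ h h' => h ((PPFormula.realize_toFormula P).1 h'))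
    (fun _ h h' => h ((PPFormula.realize_toFormula P').2 h'))

namespace AbelianModel

variable {f : A →+ 𝕋} (M : AbelianModel.{v, w, x, y} P f)

/-- All approximate models have the same limit groups: that the values on `ψ` lie in a given closed
neighbourhood of the limit group, and that some value lies in a given neighbourhood of one of its
points, are properties expressed in the theory. -/
theorem limitGroup_eq [IsTopologicalAddGroup 𝕋] [CompactSpace 𝕋] [T2Space 𝕋]
    {κ : Type} [Finite κ] (ψ : PPFormula S κ) :
    limitGroup M.rel M.hom ψ = limitGroup P f ψ := by
  apply le_antisymm
  · refine AddSubgroup.topologicalClosure_minimal _ ?_ (isClosed_limitGroup ψ)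
    rintro - ⟨b, hb, rfl⟩
    refine ClosedNhd.mem_of_forall (isClosed_limitGroup ψ) fun D' hD' => ?_
    have h := ((transfers_not_sol ψ).or (Transfers.mem hD')).realize_forall M.isApproxModel
      (fun a => by
        by_cases ha : a ∈ ψ.sol P
        · exact .inr (comp_mem_limitGroup ha)
        · exact .inl ha) b
    exact h.resolve_left (not_not.2 hb)
  · refine AddSubgroup.topologicalClosure_minimal _ ?_ (isClosed_limitGroup ψ)
    rintro - ⟨a, ha, rfl⟩
    refine mem_closure_iff.2 fun U hU haU => ?_
    obtain ⟨D', hD', hd⟩ := ClosedNhd.exists_disjoint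
      (isClosed_singleton (x := f ∘ a)) hU.isClosed_compl
      (Set.disjoint_left.2 fun c hc hcU => hcU (by rw [Set.mem_singleton_iff.1 hc]; exact haU))
    obtain ⟨b, hb, hbD⟩ := ((transfers_sol ψ).and (Transfers.mem hD')).realize_exists
      M.isApproxModel ⟨a, ha, rfl⟩
    exact ⟨M.hom ∘ b, not_not.1 (Set.disjoint_left.1 hd hbD), b, hb, rfl⟩

/-- All approximate models have the same indices of pp-definable subgroups: the existence of `n`
elements of `ψ` that are pairwise incongruent modulo `φ` is a first order sentence. -/
theorem relIndex_eq {κ : Type} [Finite κ] (φ ψ : PPFormula S κ) :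
    (φ.sol M.rel).relIndex (ψ.sol M.rel) = (φ.sol P).relIndex (ψ.sol P) := by
  refine AddSubgroup.relIndex_eq_of_forall_iff fun n => ?_
  constructor
  · contrapose!
    intro h z hz
    have hb := ((Transfers.exists_finite fun i : Fin n =>
      transfers_not_sol (f := f) (P := P) (ψ.relabel (Prod.mk i))).or
      (Transfers.exists_finite fun p : {p : Fin n × Fin n // p.1 ≠ p.2} =>
        transfers_sol (φ.diff (Prod.mk p.1.1) (Prod.mk p.1.2)))).realize_forall
      M.isApproxModel (fun a => by
        by_contra! hc
        obtain ⟨i, j, hij, hmem⟩ := h (fun i => a ∘ Prod.mk i)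
          fun i => (PPFormula.mem_sol_relabel P).1 (hc.1 i)
        exact hc.2 ⟨(i, j), hij⟩ (PPFormula.mem_sol_diff.2 hmem)) (fun p => z p.1 p.2)
    obtain ⟨i, hi⟩ | ⟨⟨⟨i, j⟩, hij⟩, hmem⟩ := hb
    · exact absurd (hz i) fun h => hi ((PPFormula.mem_sol_relabel M.rel).2 h)
    · exact ⟨i, j, hij, PPFormula.mem_sol_diff.1 hmem⟩
  · rintro ⟨z, hz, hne⟩
    obtain ⟨b, hb1, hb2⟩ := ((Transfers.forall_finite fun i : Fin n =>
      transfers_sol (f := f) (P := P) (ψ.relabel (Prod.mk i))).and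
      (Transfers.forall_finite fun p : {p : Fin n × Fin n // p.1 ≠ p.2} =>
        transfers_not_sol (φ.diff (Prod.mk p.1.1) (Prod.mk p.1.2)))).realize_exists
      M.isApproxModel ⟨fun p => z p.1 p.2,
        fun i => (PPFormula.mem_sol_relabel P).2 (hz i),
        fun p h => hne _ _ p.2 (PPFormula.mem_sol_diff.1 h)⟩
    exact ⟨fun i => b ∘ Prod.mk i, fun i => (PPFormula.mem_sol_relabel M.rel).1 (hb1 i),
      fun i j hij h => hb2 ⟨(i, j), hij⟩ (PPFormula.mem_sol_diff.2 h)⟩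

end AbelianModel

end Interpolation

/-! ### Interpolation by positive combinations, and its closure under negation -/

section Interpolation

open FirstOrder Language

variable {S : ℕ → Type v} {A : Type y} [AddCommGroup A] {P : ∀ n, S n → AddSubgroup (Fin n → A)}
  {𝕋 : Type w} [AddCommGroup 𝕋] [TopologicalSpace 𝕋] {f : A →+ 𝕋}

/-- Predicates in the variables `ι` on all approximate models. -/
abbrev UniformPred (P : ∀ n, S n → AddSubgroup (Fin n → A)) (f : A →+ 𝕋) (ι : Type) :=
  ∀ M : AbelianModel.{v, w, x, y} P f, (ι → M.carrier) → Prop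

/-- The predicate `∃ z (ψ(a, z) ∧ f(a, z) ∈ D)`. -/
def ppValue {ι κ : Type} (ψ : PPFormula S (ι ⊕ κ)) (D : Set (ι ⊕ κ → 𝕋)) :
    UniformPred.{v, w, x, y} P f ι :=
  fun M a => ∃ z : κ → M.carrier, Sum.elim a z ∈ ψ.sol M.rel ∧ M.hom ∘ Sum.elim a z ∈ D

/-- `Interpolates R R'`: some positive combination of negated pp-formulas and of formulas
`∃ z (ψ(a, z) ∧ f(a, z) ∈ D)`, with `ψ` a pp-formula, follows from `R`, and some approximation to it
implies `R'`, in all approximate models. The combination does not depend on the model. -/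
inductive Interpolates {ι : Type} :
    UniformPred.{v, w, x, y} P f ι → UniformPred.{v, w, x, y} P f ι → Prop
  | ppValue {κ : Type} [Finite κ] (ψ : PPFormula S (ι ⊕ κ)) {D D' : Set (ι ⊕ κ → 𝕋)}
      (h : ClosedNhd D D') : Interpolates (ppValue ψ D) (ppValue ψ D')
  | negPP (χ : PPFormula S ι) :
      Interpolates (fun M a => a ∉ χ.sol M.rel) (fun M a => a ∉ χ.sol M.rel)
  | and {R₁ R₁' R₂ R₂' : UniformPred P f ι} (h₁ : Interpolates R₁ R₁')
      (h₂ : Interpolates R₂ R₂') :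
      Interpolates (fun M a => R₁ M a ∧ R₂ M a) (fun M a => R₁' M a ∧ R₂' M a)
  | or {R₁ R₁' R₂ R₂' : UniformPred P f ι} (h₁ : Interpolates R₁ R₁')
      (h₂ : Interpolates R₂ R₂') :
      Interpolates (fun M a => R₁ M a ∨ R₂ M a) (fun M a => R₁' M a ∨ R₂' M a)
  | mono {R R' Q Q' : UniformPred P f ι} (h : Interpolates R R')
      (h₁ : ∀ M a, Q M a → R M a) (h₂ : ∀ M a, R' M a → Q' M a) : Interpolates Q Q'

/-- Tuples `z` with `ψ(a, z)` form a coset of the solution group of `ψ(0, z)`. -/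
theorem PPFormula.elim_mem_sol_iff {ι κ : Type} {ψ : PPFormula S (ι ⊕ κ)} {a : ι → A}
    {p z : κ → A} (hp : Sum.elim a p ∈ ψ.sol P) :
    Sum.elim a z ∈ ψ.sol P ↔ z - p ∈ ψ.atZero.sol P := by
  have h : Sum.elim a z = Sum.elim (0 : ι → A) (z - p) + Sum.elim a p := by
    rw [← Sum.elim_add_add]; simp
  rw [PPFormula.mem_sol_atZero, h]
  exact AddSubgroup.add_mem_cancel_right _ hp

namespace Interpolates

variable {ι ι' : Type}

theorem pp (ψ : PPFormula S ι) : Interpolates (P := P) (f := f) (fun M a => a ∈ ψ.sol M.rel)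
    (fun M a => a ∈ ψ.sol M.rel) := by
  refine (Interpolates.ppValue (κ := Empty) (ψ.relabel Sum.inl) .univ).mono (fun M a h => ?_)
    (fun M a h => ?_)
  · exact ⟨Empty.elim, by simpa using h, trivial⟩
  · obtain ⟨z, h, -⟩ := h
    simpa using h

theorem true : Interpolates (P := P) (f := f) (fun _ (_ : ι → _) => True) (fun _ _ => True) :=
  (pp (PPFormula.top)).mono (fun M a _ => by simp) (fun _ _ _ => trivial)

theorem false : Interpolates (P := P) (f := f) (fun _ (_ : ι → _) => False) (fun _ _ => False) :=
  (negPP (PPFormula.top)).mono (fun M a h => h.elim) (fun _ _ h => h (by simp))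

theorem relabel {R R' : UniformPred.{v, w, x, y} P f ι} (h : Interpolates R R') (e : ι → ι') :
    Interpolates (fun M (a : ι' → M.carrier) => R M (a ∘ e)) (fun M a => R' M (a ∘ e)) := by
  induction h with
  | @ppValue κ _ ψ D D' h =>
    have hc : Continuous fun (c : ι' ⊕ κ → 𝕋) => c ∘ Sum.map e (id : κ → κ) := by
      fun_prop
    refine (Interpolates.ppValue (ψ.relabel (Sum.map e id)) (h.preimage hc)).mono
      (fun M a h => ?_) (fun M a h => ?_)
    · obtain ⟨z, h1, h2⟩ := h
      refine ⟨z, by simpa only [PPFormula.mem_sol_relabel, Sum.elim_comp_map,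
        Function.comp_id] using h1, ?_⟩
      simpa only [Set.mem_preimage, Function.comp_assoc, Sum.elim_comp_map,
        Function.comp_id] using h2
    · obtain ⟨z, h1, h2⟩ := h
      refine ⟨z, by simpa only [PPFormula.mem_sol_relabel, Sum.elim_comp_map,
        Function.comp_id] using h1, ?_⟩
      simpa only [Set.mem_preimage, Function.comp_assoc, Sum.elim_comp_map,
        Function.comp_id] using h2
  | negPP χ =>
    exact (negPP (χ.relabel e)).mono (fun M a h => by simpa using h)
      (fun M a h => by simpa using h)
  | and _ _ h₁ h₂ => exact h₁.and h₂
  | or _ _ h₁ h₂ => exact h₁.or h₂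
  | mono _ h₁ h₂ ih => exact ih.mono (fun M a => h₁ M _) (fun M a => h₂ M _)

theorem exists_list {J : Type*} (l : List J) {R R' : J → UniformPred.{v, w, x, y} P f ι}
    (h : ∀ j, Interpolates (R j) (R' j)) :
    Interpolates (fun M a => ∃ j ∈ l, R j M a) (fun M a => ∃ j ∈ l, R' j M a) := by
  induction l with
  | nil => simpa using false
  | cons j l ih => simpa using (h j).or ih

theorem exists_finite {J : Type*} [Finite J] {R R' : J → UniformPred.{v, w, x, y} P f ι}
    (h : ∀ j, Interpolates (R j) (R' j)) :
    Interpolates (fun M a => ∃ j, R j M a) (fun M a => ∃ j, R' j M a) := by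
  have := Fintype.ofFinite J
  exact (exists_list Finset.univ.toList h).mono (fun M a ⟨j, hj⟩ => ⟨j, by simp, hj⟩)
    (fun M a ⟨j, _, hj⟩ => ⟨j, hj⟩)

theorem forall_finite {J : Type*} [Finite J] {R R' : J → UniformPred.{v, w, x, y} P f ι}
    (h : ∀ j, Interpolates (R j) (R' j)) :
    Interpolates (fun M a => ∀ j, R j M a) (fun M a => ∀ j, R' j M a) := by
  have := Fintype.ofFinite J
  have key : ∀ l : List J,
      Interpolates (fun M a => ∀ j ∈ l, R j M a) (fun M a => ∀ j ∈ l, R' j M a) := by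
    intro l
    induction l with
    | nil => simpa using true
    | cons j l ih => simpa using (h j).and ih
  exact (key Finset.univ.toList).mono (fun M a h j _ => h j)
    (fun M a h j => h j (by simp))

/-- Pairs of predicates for which the quantifier can be eliminated from the conjunction with any
conjunction of a predicate `ppValue ψ D` and negated pp-formulas. -/
def Eliminable {τ : Type} (R R' : UniformPred.{v, w, x, y} P f (ι ⊕ τ)) : Prop :=
  ∀ (κ : Type) [Finite κ] (ψ : PPFormula S ((ι ⊕ τ) ⊕ κ)) (D D' : Set ((ι ⊕ τ) ⊕ κ → 𝕋))
    (_ : ClosedNhd D D') (l : List (PPFormula S (ι ⊕ τ))),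
    Interpolates
      (fun M a => ∃ u : τ → M.carrier, R M (Sum.elim a u) ∧
        _root_.ppValue ψ D M (Sum.elim a u) ∧ ∀ χ ∈ l, Sum.elim a u ∉ χ.sol M.rel)
      (fun M a => ∃ u : τ → M.carrier, R' M (Sum.elim a u) ∧
        _root_.ppValue ψ D' M (Sum.elim a u) ∧ ∀ χ ∈ l, Sum.elim a u ∉ χ.sol M.rel)

/-- Since the existential quantifier distributes over disjunctions, it suffices to eliminate it from
conjunctions of basic formulas; those are collected in the arguments `ψ`, `D` and `l` of
`Eliminable`. -/
theorem Eliminable.and {τ : Type} {R R' : UniformPred.{v, w, x, y} P f (ι ⊕ τ)}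
    (h : Interpolates R R') : ∀ {Q Q' : UniformPred.{v, w, x, y} P f (ι ⊕ τ)}, Eliminable Q Q' →
    Eliminable (fun M a => R M a ∧ Q M a) (fun M a => R' M a ∧ Q' M a) := by
  induction h with
  | @ppValue κ₁ _ ψ₁ D₁ D₁' h₁ =>
    intro Q Q' hQ κ _ ψ D D' h l
    let e₁ : (ι ⊕ τ) ⊕ κ₁ → (ι ⊕ τ) ⊕ (κ₁ ⊕ κ) := Sum.map id Sum.inl
    let e : (ι ⊕ τ) ⊕ κ → (ι ⊕ τ) ⊕ (κ₁ ⊕ κ) := Sum.map id Sum.inr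
    have hc₁ : Continuous fun c : (ι ⊕ τ) ⊕ (κ₁ ⊕ κ) → 𝕋 => c ∘ e₁ := by fun_prop
    have hc : Continuous fun c : (ι ⊕ τ) ⊕ (κ₁ ⊕ κ) → 𝕋 => c ∘ e := by fun_prop
    refine (hQ (κ₁ ⊕ κ) ((ψ₁.relabel e₁).inf (ψ.relabel e)) _ _
      ((h₁.preimage hc₁).inter (h.preimage hc)) l).mono ?_ ?_
    · rintro M a ⟨u, ⟨⟨z₁, h1, h2⟩, h3⟩, ⟨z, h4, h5⟩, h6⟩
      refine ⟨u, h3, ⟨Sum.elim z₁ z, ?_, ?_, ?_⟩, h6⟩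
      · simpa [e₁, e, Sum.elim_comp_map] using ⟨h1, h4⟩
      · simpa [e₁, Function.comp_assoc, Sum.elim_comp_map] using h2
      · simpa [e, Function.comp_assoc, Sum.elim_comp_map] using h5
    · rintro M a ⟨u, h3, ⟨z, h1, h2, h5⟩, h6⟩
      rw [PPFormula.mem_sol_inf] at h1
      refine ⟨u, ⟨⟨z ∘ Sum.inl, ?_, ?_⟩, h3⟩, ⟨z ∘ Sum.inr, ?_, ?_⟩, h6⟩
      · simpa [e₁, Sum.elim_comp_map] using h1.1
      · simpa [e₁, Function.comp_assoc, Sum.elim_comp_map] using h2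
      · simpa [e, Sum.elim_comp_map] using h1.2
      · simpa [e, Function.comp_assoc, Sum.elim_comp_map] using h5
  | negPP χ =>
    intro Q Q' hQ κ _ ψ D D' h l
    refine (hQ κ ψ D D' h (χ :: l)).mono (fun M a => ?_) (fun M a => ?_)
    · rintro ⟨u, ⟨h1, h2⟩, h3, h4⟩
      exact ⟨u, h2, h3, by simpa using ⟨h1, h4⟩⟩
    · rintro ⟨u, h2, h3, h4⟩
      rw [List.forall_mem_cons] at h4
      exact ⟨u, ⟨h4.1, h2⟩, h3, h4.2⟩
  | and _ _ ih₁ ih₂ =>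
    intro Q Q' hQ κ _ ψ D D' h l
    refine (ih₁ (ih₂ hQ) κ ψ D D' h l).mono (fun M a => ?_) (fun M a => ?_)
    · rintro ⟨u, ⟨⟨h1, h2⟩, h3⟩, h4⟩
      exact ⟨u, ⟨h1, h2, h3⟩, h4⟩
    · rintro ⟨u, ⟨h1, h2, h3⟩, h4⟩
      exact ⟨u, ⟨⟨h1, h2⟩, h3⟩, h4⟩
  | or _ _ ih₁ ih₂ =>
    intro Q Q' hQ κ _ ψ D D' h l
    refine ((ih₁ hQ κ ψ D D' h l).or (ih₂ hQ κ ψ D D' h l)).mono (fun M a => ?_) (fun M a => ?_)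
    · rintro ⟨u, ⟨h1 | h1, h2⟩, h3⟩
      · exact .inl ⟨u, ⟨h1, h2⟩, h3⟩
      · exact .inr ⟨u, ⟨h1, h2⟩, h3⟩
    · rintro (⟨u, ⟨h1, h2⟩, h3⟩ | ⟨u, ⟨h1, h2⟩, h3⟩)
      · exact ⟨u, ⟨.inl h1, h2⟩, h3⟩
      · exact ⟨u, ⟨.inr h1, h2⟩, h3⟩
  | mono _ h₁ h₂ ih =>
    intro Q Q' hQ κ _ ψ D D' h l
    refine (ih hQ κ ψ D D' h l).mono (fun M a => ?_) (fun M a => ?_)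
    · rintro ⟨u, ⟨h3, h4⟩, h5⟩
      exact ⟨u, ⟨h₁ _ _ h3, h4⟩, h5⟩
    · rintro ⟨u, ⟨h3, h4⟩, h5⟩
      exact ⟨u, ⟨h₂ _ _ h3, h4⟩, h5⟩

variable [IsTopologicalAddGroup 𝕋] [CompactSpace 𝕋] [T2Space 𝕋]

/-- The values of `f` on the coset `{z | ψ(a, z)}` are dense in a coset of the limit group `Q` of
`ψ(0, z)`. Hence whether some `z` in the coset has `f(a, z) ∈ D` can be decided from the value of
`f` at an arbitrary point of the coset, up to approximation. -/
theorem not_ppValue {κ : Type} [Finite κ] (ψ : PPFormula S (ι ⊕ κ)) {D D' : Set (ι ⊕ κ → 𝕋)}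
    (h : ClosedNhd D D') :
    Interpolates (P := P) (f := f) (fun M a => ¬_root_.ppValue ψ D' M a)
      (fun M a => ¬_root_.ppValue ψ D M a) := by
  let Q := limitGroup P f ψ.atZero
  let add : (ι ⊕ κ → 𝕋) → (κ → 𝕋) → (ι ⊕ κ → 𝕋) := fun c q => c + Sum.elim (0 : ι → 𝕋) q
  have hadd : Continuous fun p : (ι ⊕ κ → 𝕋) × (κ → 𝕋) => add p.1 p.2 := by
    refine continuous_pi fun i => ?_
    rcases i with i | i
    · simp only [add, Pi.add_apply, Sum.elim_inl]; fun_prop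
    · simp only [add, Pi.add_apply, Sum.elim_inr]; fun_prop
  -- `c` stands for the value at a point of the coset: in `E` no translate of it by `Q` is in the
  -- interior of `D'`, in `E₂` some translate is in `D`
  let E : Set (ι ⊕ κ → 𝕋) := {c | ∀ q ∈ Q, add c q ∉ interior D'}
  let E₂ : Set (ι ⊕ κ → 𝕋) := Prod.fst '' {p : (ι ⊕ κ → 𝕋) × (κ → 𝕋) | p.2 ∈ Q ∧ add p.1 p.2 ∈ D}
  have hE : IsClosed E := by
    have : E = ⋂ q ∈ Q, (fun c => add c q) ⁻¹' (interior D')ᶜ := by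
      ext c; simp [E]
    rw [this]
    exact isClosed_biInter fun q _ => isOpen_interior.isClosed_compl.preimage
      (hadd.comp (Continuous.prodMk_left q))
  have hE₂ : IsClosed E₂ := by
    refine isClosedMap_fst_of_compactSpace _ (IsClosed.inter ?_ ?_)
    · exact (isClosed_limitGroup ψ.atZero).preimage continuous_snd
    · exact h.1.preimage hadd
  have hd : Disjoint E E₂ := by
    refine Set.disjoint_left.2 ?_
    rintro c hc ⟨⟨c, q⟩, ⟨hq, hcq⟩, rfl⟩
    exact hc q hq (h.3 hcq)
  obtain ⟨E', hE', hd'⟩ := ClosedNhd.exists_disjoint hE hE₂ hd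
  have hval : ∀ (M : AbelianModel P f) (a : ι → M.carrier) (p g : κ → M.carrier),
      M.hom ∘ Sum.elim a (p + g) = add (M.hom ∘ Sum.elim a p) (M.hom ∘ g) := by
    intro M a p g
    ext (i | i) <;> simp [add]
  refine ((negPP ψ.ex).or (.ppValue ψ hE')).mono (fun M a hn => ?_) (fun M a hor => ?_)
  · by_cases hp : ∃ p : κ → M.carrier, Sum.elim a p ∈ ψ.sol M.rel
    · obtain ⟨p, hp⟩ := hp
      refine .inr ⟨p, hp, fun q hq hint => hn ?_⟩
      have hO : IsOpen ((fun q => add (M.hom ∘ Sum.elim a p) q) ⁻¹' interior D') :=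
        isOpen_interior.preimage (hadd.comp (Continuous.prodMk_right _))
      rw [show Q = limitGroup M.rel M.hom ψ.atZero from (M.limitGroup_eq _).symm] at hq
      obtain ⟨-, hx, g, hg, rfl⟩ := mem_closure_iff.1 hq _ hO hint
      refine ⟨p + g, (PPFormula.elim_mem_sol_iff hp).2 (by simpa using hg), ?_⟩
      rw [hval]
      exact interior_subset hx
    · exact .inl fun h => hp ((PPFormula.mem_sol_ex _).1 h)
  · rintro ⟨z, hz, hzD⟩
    obtain hn | ⟨p, hp, hpE⟩ := hor
    · exact hn ((PPFormula.mem_sol_ex _).2 ⟨z, hz⟩)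
    · refine Set.disjoint_left.1 hd' hpE ⟨(_, M.hom ∘ (z - p)), ⟨?_, ?_⟩, rfl⟩
      · have := comp_mem_limitGroup (f := M.hom) ((PPFormula.elim_mem_sol_iff hp).1 hz)
        rwa [M.limitGroup_eq] at this
      · change add (M.hom ∘ Sum.elim a p) (M.hom ∘ (z - p)) ∈ D
        rw [← hval]
        simpa using hzD

theorem not {R R' : UniformPred.{v, w, x, y} P f ι} (h : Interpolates R R') :
    Interpolates (fun M a => ¬R' M a) (fun M a => ¬R M a) := by
  induction h with
  | ppValue ψ h => exact not_ppValue ψ h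
  | negPP χ => exact (pp χ).mono (fun M a h => not_not.1 h) (fun M a h => not_not.2 h)
  | and _ _ h₁ h₂ => exact (h₁.or h₂).mono (fun M a h => by tauto) (fun M a h => by tauto)
  | or _ _ h₁ h₂ => exact (h₁.and h₂).mono (fun M a h => by tauto) (fun M a h => by tauto)
  | mono _ h₁ h₂ ih => exact ih.mono (fun M a h h' => h (h₂ M a h')) (fun M a h h' => h (h₁ M a h'))

end Interpolates

end Interpolation

/-! ### Elimination of the existential quantifier -/

section Elimination

open FirstOrder Language

variable {S : ℕ → Type v} {A : Type y} [AddCommGroup A] {P : ∀ n, S n → AddSubgroup (Fin n → A)}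
  {𝕋 : Type w} [AddCommGroup 𝕋] [TopologicalSpace 𝕋] {f : A →+ 𝕋}
  [IsTopologicalAddGroup 𝕋]

theorem limitGroup_mono {κ : Type} {φ ψ : PPFormula S κ} (h : φ.sol P ≤ ψ.sol P) :
    limitGroup P f φ ≤ limitGroup P f ψ :=
  AddSubgroup.topologicalClosure_mono (AddSubgroup.map_mono h)

/-- If `φ` has finite index in `ψ`, then the values of `f` on `ψ` meet all cosets of the limit group
of `φ` in the limit group of `ψ`, since the union of those cosets that are met is closed. -/
theorem limitGroup_eq_sup {κ : Type} {φ ψ : PPFormula S κ} (h : φ.sol P ≤ ψ.sol P)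
    (hfin : (φ.sol P).relIndex (ψ.sol P) ≠ 0) :
    limitGroup P f ψ = limitGroup P f φ ⊔ (ψ.sol P).map (f.compLeft κ) := by
  apply le_antisymm
  · refine AddSubgroup.topologicalClosure_minimal _ le_sup_right ?_
    refine isClosed_of_relIndex_ne_zero (isClosed_limitGroup φ) (K := _) ?_ le_rfl
      fun a ha c hc => add_mem ha (AddSubgroup.mem_sup_left hc)
    rw [AddSubgroup.relIndex_sup_left, ← AddSubgroup.relIndex_comap]
    refine fun h0 => hfin (AddSubgroup.relIndex_eq_zero_of_le_left (fun a ha => ?_) h0)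
    exact comp_mem_limitGroup ha
  · exact sup_le (limitGroup_mono h) (AddSubgroup.le_topologicalClosure _)

theorem relIndex_limitGroup {κ : Type} {φ ψ : PPFormula S κ} (h : φ.sol P ≤ ψ.sol P)
    (hfin : (φ.sol P).relIndex (ψ.sol P) ≠ 0) :
    (limitGroup P f φ).relIndex (limitGroup P f ψ) =
      ((limitGroup P f φ).comap (f.compLeft κ)).relIndex (ψ.sol P) := by
  rw [limitGroup_eq_sup h hfin, AddSubgroup.relIndex_sup_left, ← AddSubgroup.relIndex_comap]

theorem relIndex_limitGroup_ne_zero {κ : Type} {φ ψ : PPFormula S κ} (h : φ.sol P ≤ ψ.sol P)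
    (hfin : (φ.sol P).relIndex (ψ.sol P) ≠ 0) :
    (limitGroup P f φ).relIndex (limitGroup P f ψ) ≠ 0 := by
  rw [relIndex_limitGroup h hfin]
  exact fun h0 => hfin (AddSubgroup.relIndex_eq_zero_of_le_left
    (fun a ha => comp_mem_limitGroup ha) h0)

/-- The number of cosets of `φ` in `ψ` on which the values of `f` lie in the limit group of `φ`. -/
theorem relIndex_inf_comap_limitGroup {κ : Type} {φ ψ : PPFormula S κ} (h : φ.sol P ≤ ψ.sol P)
    (hfin : (φ.sol P).relIndex (ψ.sol P) ≠ 0) :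
    (φ.sol P).relIndex (ψ.sol P ⊓ (limitGroup P f φ).comap (f.compLeft κ)) =
      (φ.sol P).relIndex (ψ.sol P) / (limitGroup P f φ).relIndex (limitGroup P f ψ) := by
  have h1 := AddSubgroup.relIndex_mul_relIndex (φ.sol P)
    (ψ.sol P ⊓ (limitGroup P f φ).comap (f.compLeft κ)) (ψ.sol P)
    (le_inf h fun a ha => comp_mem_limitGroup ha) inf_le_left
  rw [AddSubgroup.inf_relIndex_left, ← relIndex_limitGroup h hfin] at h1
  exact Nat.eq_div_of_mul_eq_left (relIndex_limitGroup_ne_zero h hfin) h1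

theorem AbelianModel.limitGroup_eq_sup [CompactSpace 𝕋] [T2Space 𝕋]
    (M : AbelianModel.{v, w, x, y} P f) {κ : Type} [Finite κ] {φ ψ : PPFormula S κ}
    (h : φ.sol M.rel ≤ ψ.sol M.rel) (hfin : (φ.sol P).relIndex (ψ.sol P) ≠ 0) :
    limitGroup P f ψ = limitGroup P f φ ⊔ (ψ.sol M.rel).map (M.hom.compLeft κ) := by
  have h1 := _root_.limitGroup_eq_sup (f := M.hom) h (by rwa [M.relIndex_eq])
  rwa [M.limitGroup_eq, M.limitGroup_eq] at h1

theorem AbelianModel.relIndex_inf_comap_limitGroup [CompactSpace 𝕋] [T2Space 𝕋]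
    (M : AbelianModel.{v, w, x, y} P f) {κ : Type} [Finite κ] {φ ψ : PPFormula S κ}
    (h : φ.sol M.rel ≤ ψ.sol M.rel) (hfin : (φ.sol P).relIndex (ψ.sol P) ≠ 0) :
    (φ.sol M.rel).relIndex (ψ.sol M.rel ⊓ (limitGroup P f φ).comap (M.hom.compLeft κ)) =
      (φ.sol P).relIndex (ψ.sol P) / (limitGroup P f φ).relIndex (limitGroup P f ψ) := by
  have h1 := _root_.relIndex_inf_comap_limitGroup (f := M.hom) h (by rwa [M.relIndex_eq])
  rwa [M.limitGroup_eq, M.limitGroup_eq, M.relIndex_eq φ ψ] at h1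

/-- The pp-formula `ψ ∧ ⋀_{j ∈ s} χ j`. -/
noncomputable def PPFormula.infs {ι J : Type} (ψ : PPFormula S ι) (χ : J → PPFormula S ι)
    (s : Finset J) : PPFormula S ι := ψ.inf (.infList (s.toList.map χ))

@[simp]
theorem PPFormula.mem_sol_infs {ι J : Type} {ψ : PPFormula S ι} {χ : J → PPFormula S ι}
    {s : Finset J} {a : ι → A} :
    a ∈ (ψ.infs χ s).sol P ↔ a ∈ ψ.sol P ∧ ∀ j ∈ s, a ∈ (χ j).sol P := by
  simp [infs]

theorem PPFormula.sol_atZero_infs_mono {ι κ J : Type} {ψ : PPFormula S (ι ⊕ κ)}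
    {χ : J → PPFormula S (ι ⊕ κ)} {s t : Finset J} (h : s ⊆ t) :
    (ψ.infs χ t).atZero.sol P ≤ (ψ.infs χ s).atZero.sol P := by
  intro a
  simp only [mem_sol_atZero, mem_sol_infs]
  exact fun h' => ⟨h'.1, fun j hj => h'.2 j (h hj)⟩

theorem PPFormula.relIndex_atZero_infs_ne_zero {ι κ J : Type} [Fintype J] {ψ : PPFormula S (ι ⊕ κ)}
    {χ : J → PPFormula S (ι ⊕ κ)}
    (hχ : ∀ j, ((χ j).atZero.sol P).relIndex (ψ.atZero.sol P) ≠ 0) (s : Finset J) :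
    ((ψ.infs χ Finset.univ).atZero.sol P).relIndex ((ψ.infs χ s).atZero.sol P) ≠ 0 := by
  have h1 : (ψ.infs χ Finset.univ).atZero.sol P =
      (⨅ j, (χ j).atZero.sol P) ⊓ ψ.atZero.sol P := by
    ext a
    simp [AddSubgroup.mem_iInf, and_comm]
  have h2 : ((ψ.infs χ Finset.univ).atZero.sol P).relIndex (ψ.atZero.sol P) ≠ 0 := by
    rw [h1, AddSubgroup.inf_relIndex_right]
    exact AddSubgroup.relIndex_iInf_ne_zero hχ
  refine fun h0 => h2 (AddSubgroup.relIndex_eq_zero_of_le_right (fun a => ?_) h0)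
  simp only [mem_sol_atZero, mem_sol_infs]
  exact fun h => h.1

theorem continuous_add_elim {ι κ : Type} (c : ι ⊕ κ → 𝕋) :
    Continuous fun q : κ → 𝕋 => c + Sum.elim (0 : ι → 𝕋) q := by
  refine continuous_pi fun i => ?_
  rcases i with i | i
  · simp only [Pi.add_apply, Sum.elim_inl]; fun_prop
  · simp only [Pi.add_apply, Sum.elim_inr]; fun_prop

namespace Interpolates

variable [CompactSpace 𝕋] [T2Space 𝕋] {ι κ : Type} [Finite κ]

/-- Elimination of quantifiers when the excluded cosets have finite index: by the count of cosets
in `exists_avoiding_iff_sum_pos`, it suffices to know which intersections of the excluded cosets are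
nonempty, and the values of `f` at points of them. The numbers that occur in the count are the same
in all approximate models. -/
theorem exists_avoiding_of_finiteIndex {J : Type} [Finite J] (ψ : PPFormula S (ι ⊕ κ))
    (χ : J → PPFormula S (ι ⊕ κ))
    (hχ : ∀ j, ((χ j).atZero.sol P).relIndex (ψ.atZero.sol P) ≠ 0)
    {D D' : Set (ι ⊕ κ → 𝕋)} (h : ClosedNhd D D') :
    Interpolates (P := P) (f := f)
      (fun (M : AbelianModel.{v, w, x, y} P f) a => ∃ z : κ → M.carrier,
        Sum.elim a z ∈ ψ.sol M.rel ∧ M.hom ∘ Sum.elim a z ∈ D ∧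
        ∀ j, Sum.elim a z ∉ (χ j).sol M.rel)
      (fun (M : AbelianModel.{v, w, x, y} P f) a => ∃ z : κ → M.carrier,
        Sum.elim a z ∈ ψ.sol M.rel ∧ M.hom ∘ Sum.elim a z ∈ D' ∧
        ∀ j, Sum.elim a z ∉ (χ j).sol M.rel) := by
  classical
  have := Fintype.ofFinite J
  obtain ⟨D₁, hD₁, hD₁'⟩ := h.exists_between
  let θ : Finset J → PPFormula S (ι ⊕ κ) := ψ.infs χ
  have hθ : ∀ (M : AbelianModel.{v, w, x, y} P f) s (a : ι ⊕ κ → M.carrier),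
      a ∈ (θ s).sol M.rel ↔ a ∈ ψ.sol M.rel ∧ ∀ j ∈ s, a ∈ (χ j).sol M.rel :=
    fun M s a => PPFormula.mem_sol_infs
  -- `θ s` defines the intersection of the cosets `χ j` with `j ∈ s`, and `H` the least of the
  -- subgroups of which these intersections are cosets
  let H : PPFormula S κ := (θ Finset.univ).atZero
  have hH : ∀ (M : AbelianModel.{v, w, x, y} P f) s,
      H.sol M.rel ≤ (θ s).atZero.sol M.rel :=
    fun M s => PPFormula.sol_atZero_infs_mono (Finset.subset_univ s)
  have hHA : ∀ s, H.sol P ≤ (θ s).atZero.sol P :=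
    fun s => PPFormula.sol_atZero_infs_mono (Finset.subset_univ s)
  have hfinA : ∀ s, (H.sol P).relIndex ((θ s).atZero.sol P) ≠ 0 :=
    PPFormula.relIndex_atZero_infs_ne_zero hχ
  have hfin : ∀ (M : AbelianModel.{v, w, x, y} P f) s,
      (H.sol M.rel).relIndex ((θ s).atZero.sol M.rel) ≠ 0 := fun M s => by
    rw [M.relIndex_eq]; exact hfinA s
  let Q : Finset J → AddSubgroup (κ → 𝕋) := fun s => limitGroup P f (θ s).atZero
  let QH : AddSubgroup (κ → 𝕋) := limitGroup P f H
  have hQ : ∀ (M : AbelianModel.{v, w, x, y} P f) s,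
      Q s = QH ⊔ ((θ s).atZero.sol M.rel).map (M.hom.compLeft κ) :=
    fun M s => M.limitGroup_eq_sup (hH M s) (hfinA s)
  -- the number of cosets of `H` in the subgroup of `θ s` on which `f` has values in `QH`
  let c : Finset J → ℕ := fun s => (H.sol P).relIndex ((θ s).atZero.sol P) / QH.relIndex (Q s)
  have hc : ∀ (M : AbelianModel.{v, w, x, y} P f) s, (H.sol M.rel).relIndex
      ((θ s).atZero.sol M.rel ⊓ QH.comap (M.hom.compLeft κ)) = c s :=
    fun M s => M.relIndex_inf_comap_limitGroup (hH M s) (hfinA s)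
  -- `Q s` is closed and open in `Q ∅`
  have hQQ : ∀ s, Q s ≤ Q ∅ := fun s =>
    limitGroup_mono (PPFormula.sol_atZero_infs_mono (Finset.empty_subset s))
  have hQfin : ∀ s, (Q s).relIndex (Q ∅) ≠ 0 := fun s h0 =>
    relIndex_limitGroup_ne_zero (f := f) (hHA ∅) (hfinA ∅)
      (AddSubgroup.relIndex_eq_zero_of_le_left (limitGroup_mono (hHA s)) h0)
  have hcl : ∀ s, IsClosed (Q s : Set (κ → 𝕋)) := fun s => isClosed_limitGroup _
  have hcl' : ∀ s, IsClosed ((Q ∅ : Set (κ → 𝕋)) \ Q s) := fun s =>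
    isClosed_of_relIndex_ne_zero (hcl s) (hQfin s) Set.sdiff_subset fun a ha c hc =>
      ⟨add_mem ha.1 (hQQ s hc), fun h => ha.2 ((AddSubgroup.add_mem_cancel_right _ hc).1 h)⟩
  -- closed neighbourhoods that distinguish `Q s` from its complement in `Q ∅`
  have hE : ∀ s (b : Prop), ∃ E E' : Set (κ → 𝕋), ClosedNhd E E' ∧
      (∀ q ∈ Q ∅, (q ∈ Q s ↔ b) → q ∈ E) ∧ ∀ q ∈ Q ∅, q ∈ E' → (q ∈ Q s ↔ b) := by
    intro s b
    by_cases hb : b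
    · obtain ⟨E', h1, h2⟩ := ClosedNhd.exists_disjoint (hcl s) (hcl' s) Set.disjoint_sdiff_right
      refine ⟨_, E', h1, fun q _ h => h.2 hb, fun q hq hqE => ⟨fun _ => hb, fun _ => ?_⟩⟩
      by_contra hn
      exact Set.disjoint_left.1 h2 hqE ⟨hq, hn⟩
    · obtain ⟨E', h1, h2⟩ := ClosedNhd.exists_disjoint (hcl' s) (hcl s) Set.disjoint_sdiff_left
      exact ⟨_, E', h1, fun q hq h => ⟨hq, fun hqs => hb (h.1 hqs)⟩, fun q hq hqE =>
        ⟨fun hqs => absurd hqs (Set.disjoint_left.1 h2 hqE), fun h => absurd h hb⟩⟩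
  choose E E' hEE hE1 hE2 using hE
  -- `𝒥` is the family of `s` for which the intersection is nonempty, `T` the subfamily of those for
  -- which the difference of the values at points of `θ ∅` and of `θ s` is in `Q s`
  let I := {q : Finset (Finset J) × Finset (Finset J) //
    ∅ ∈ q.1 ∧ q.2 ⊆ q.1 ∧ 0 < ∑ s ∈ q.2, (-1 : ℤ) ^ s.card * (c s : ℤ)}
  let Ψ : I → PPFormula S (ι ⊕ (Finset J × κ)) := fun q =>
    .infList (q.1.1.toList.map fun s => (θ s).relabel (Sum.map id (Prod.mk s)))
  have hΨ : ∀ (M : AbelianModel.{v, w, x, y} P f) q (a : ι → M.carrier)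
      (p : Finset J × κ → M.carrier),
      Sum.elim a p ∈ (Ψ q).sol M.rel ↔
        ∀ s ∈ q.1.1, Sum.elim a (p ∘ Prod.mk s) ∈ (θ s).sol M.rel := by
    intro M q a p
    simp only [Ψ, PPFormula.mem_sol_infList, List.mem_map, Finset.mem_toList, forall_exists_index,
      and_imp, forall_apply_eq_imp_iff₂, PPFormula.mem_sol_relabel, Sum.elim_comp_map,
      Function.comp_id]
  let diff : Finset J → (ι ⊕ (Finset J × κ) → 𝕋) → κ → 𝕋 := fun s c k =>
    c (Sum.inr (∅, k)) - c (Sum.inr (s, k))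
  have hdiff : ∀ s, Continuous (diff s) := fun s => by fun_prop
  let rest : (ι ⊕ (Finset J × κ) → 𝕋) → ι ⊕ κ → 𝕋 := fun c => c ∘ Sum.map id (Prod.mk ∅)
  have hrest : Continuous rest := by fun_prop
  -- the variables `p s` stand for points of the intersections with `s ∈ 𝒥`, and `p ∅` for the tuple
  -- whose value is to be attained
  have hblock := exists_finite fun q : I =>
    (Interpolates.ppValue (P := P) (f := f) (Ψ q) ((hD₁.preimage hrest).inter
      (.iInter fun s : {s // s ∈ q.1.1} => (hEE s (s.1 ∈ q.1.2)).preimage (hdiff s)))).and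
      (forall_finite fun s : {s // s ∉ q.1.1} => negPP (θ s).ex)
  refine hblock.mono (fun M a hz => ?_) (fun M a hq => ?_)
  · obtain ⟨z, hzψ, hzD, hzχ⟩ := hz
    let 𝒥 : Finset (Finset J) :=
      Finset.univ.filter fun s => ∃ z : κ → M.carrier, Sum.elim a z ∈ (θ s).sol M.rel
    have h𝒥 : ∀ s, s ∈ 𝒥 ↔ ∃ z : κ → M.carrier, Sum.elim a z ∈ (θ s).sol M.rel := by simp [𝒥]
    have hp : ∃ p : Finset J → κ → M.carrier, p ∅ = z ∧
        ∀ s ∈ 𝒥, Sum.elim a (p s) ∈ (θ s).sol M.rel := by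
      choose! p hp using fun s => (h𝒥 s).1
      refine ⟨Function.update p ∅ z, by simp, fun s hs => ?_⟩
      by_cases h0 : s = ∅
      · subst h0
        rw [Function.update_self, hθ]
        exact ⟨hzψ, by simp⟩
      · rw [Function.update_of_ne h0]
        exact hp s hs
    obtain ⟨p, hp0, hp⟩ := hp
    have h0 : ∅ ∈ 𝒥 := (h𝒥 ∅).2 ⟨z, by rw [hθ]; exact ⟨hzψ, by simp⟩⟩
    let T := 𝒥.filter fun s => M.hom ∘ z - M.hom ∘ p s ∈ Q s
    have hsum := (exists_avoiding_iff_sum_pos (M.hom.compLeft κ) (hH M) (hfin M ∅) (hQ M)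
      (X := {z | Sum.elim a z ∈ ψ.sol M.rel}) (B := fun j => {z | Sum.elim a z ∈ (χ j).sol M.rel})
      𝒥 p (fun s hs z => by
        rw [← PPFormula.elim_mem_sol_iff (hp s hs), hθ]; rfl)
      (fun s hs z hz => by
        by_contra! hc
        exact hs ((h𝒥 s).2 ⟨z, (hθ _ _ _).2 ⟨hz, hc⟩⟩)) (M.hom ∘ z) (T := T)
      (fun s => by simp only [T, Finset.mem_filter]; rfl)).1
      ⟨z, hzψ, by
        change M.hom ∘ z - M.hom ∘ z ∈ QH
        simp, hzχ⟩
    simp only [hc] at hsum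
    refine ⟨⟨(𝒥, T), h0, Finset.filter_subset _ _, hsum⟩,
      ⟨fun k => p k.1 k.2, (hΨ _ _ _ _).2 hp, ?_, ?_⟩, ?_⟩
    · have h1 : rest (M.hom ∘ Sum.elim a fun k => p k.1 k.2) = M.hom ∘ Sum.elim a z := by
        ext (i | i) <;> simp [rest, hp0]
      change rest (M.hom ∘ Sum.elim a fun k => p k.1 k.2) ∈ D
      rwa [h1]
    · refine Set.mem_iInter.2 fun s => hE1 _ _ _ ?_ ?_
      · have h1 := (PPFormula.elim_mem_sol_iff (p := p s) (z := z) (a := a) (P := M.rel) (ψ := θ ∅)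
          ((hθ _ _ _).2 ⟨((hθ _ _ _).1 (hp s s.2)).1, by simp⟩)).1
          ((hθ _ _ _).2 ⟨hzψ, by simp⟩)
        have h2 := comp_mem_limitGroup (f := M.hom) h1
        rw [M.limitGroup_eq] at h2
        convert h2 using 1
        ext k
        simp [diff, hp0]
      · have : diff s (M.hom ∘ Sum.elim a fun k => p k.1 k.2) = M.hom ∘ z - M.hom ∘ p s := by
          ext k
          simp [diff, hp0]
        rw [this]
        simp only [T, Finset.mem_filter]
        exact ⟨fun h => ⟨s.2, h⟩, fun h => h.2⟩
    · rintro ⟨s, hs⟩ hmem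
      exact hs ((h𝒥 s).2 ((PPFormula.mem_sol_ex _).1 hmem))
  · obtain ⟨⟨⟨𝒥, T⟩, h0, hT, hsum⟩, ⟨p, hp, hpD, hpE⟩, hneg⟩ := hq
    rw [hΨ] at hp
    have hpψ : ∀ s ∈ 𝒥, Sum.elim a (p ∘ Prod.mk s) ∈ ψ.sol M.rel := fun s hs =>
      ((hθ _ _ _).1 (hp s hs)).1
    obtain ⟨z, hzψ, hzd, hz⟩ := (exists_avoiding_iff_sum_pos (M.hom.compLeft κ) (hH M) (hfin M ∅)
      (hQ M) (X := {z | Sum.elim a z ∈ ψ.sol M.rel})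
      (B := fun j => {z | Sum.elim a z ∈ (χ j).sol M.rel})
      𝒥 (fun s => p ∘ Prod.mk s) (fun s hs z => by
        rw [← PPFormula.elim_mem_sol_iff (hp s hs), hθ]; rfl)
      (fun s hs z hz => by
        by_contra! hc
        exact hneg ⟨s, hs⟩ ((PPFormula.mem_sol_ex _).2 ⟨z, (hθ _ _ _).2 ⟨hz, hc⟩⟩))
      (M.hom ∘ p ∘ Prod.mk ∅) (T := T)
      (fun s => by
        have h3 : ∀ hs : s ∈ 𝒥, M.hom ∘ p ∘ Prod.mk ∅ - M.hom ∘ p ∘ Prod.mk s ∈ Q s ↔ s ∈ T := by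
          intro hs
          refine hE2 s (s ∈ T) _ ?_ (Set.mem_iInter.1 hpE ⟨s, hs⟩)
          have h1 := (PPFormula.elim_mem_sol_iff (P := M.rel) (ψ := θ ∅)
            ((hθ _ _ _).2 ⟨hpψ s hs, by simp⟩)).1
            ((hθ _ _ _).2 ⟨hpψ ∅ h0, by simp⟩)
          have h2 := comp_mem_limitGroup (f := M.hom) h1
          rw [M.limitGroup_eq] at h2
          convert h2 using 1
          ext k
          simp
        exact ⟨fun h => ⟨hT h, (h3 (hT h)).2 h⟩, fun h => (h3 h.1).1 h.2⟩)).2 (by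
          simpa only [hc] using hsum)
    -- the value at `p ∅` is approximated on the coset of `z`
    have hO := (isOpen_interior (s := D')).preimage
      (continuous_add_elim (M.hom ∘ Sum.elim a z))
    have hmem : M.hom ∘ p ∘ Prod.mk ∅ - M.hom ∘ z ∈ (limitGroup M.rel M.hom H) := by
      rw [M.limitGroup_eq]
      exact hzd
    obtain ⟨-, hx, g, hg, rfl⟩ := mem_closure_iff.1 hmem _ hO (by
      apply hD₁'.3
      have hpD' : M.hom ∘ Sum.elim a p ∘ Sum.map id (Prod.mk ∅) ∈ D₁ := hpD
      rw [Sum.elim_comp_map] at hpD'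
      convert hpD' using 1
      ext (i | i) <;> simp)
    have hg' := (hθ _ _ _).1 ((PPFormula.mem_sol_atZero _).1 hg)
    refine ⟨z + g, ?_, ?_, fun j hj => hz j ?_⟩
    · refine (PPFormula.elim_mem_sol_iff hzψ).2 ?_
      simpa using hg'.1
    · rw [comp_elim_add]
      exact interior_subset hx
    · refine (PPFormula.elim_mem_sol_iff hj).2 ?_
      have := neg_mem ((PPFormula.mem_sol_atZero _).2 (hg'.2 j (Finset.mem_univ j)))
      simpa using this

/-- Elimination of quantifiers from a conjunction of basic formulas: excluded cosets of infinite
index do not matter, since finitely many of them cannot cover a neighbourhood that `f` defines. -/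
theorem exists_avoiding {J : Type} [Finite J] (ψ : PPFormula S (ι ⊕ κ))
    (χ : J → PPFormula S (ι ⊕ κ)) {D D' : Set (ι ⊕ κ → 𝕋)} (h : ClosedNhd D D') :
    Interpolates (P := P) (f := f)
      (fun (M : AbelianModel.{v, w, x, y} P f) a => ∃ z : κ → M.carrier,
        Sum.elim a z ∈ ψ.sol M.rel ∧ M.hom ∘ Sum.elim a z ∈ D ∧
        ∀ j, Sum.elim a z ∉ (χ j).sol M.rel)
      (fun (M : AbelianModel.{v, w, x, y} P f) a => ∃ z : κ → M.carrier,
        Sum.elim a z ∈ ψ.sol M.rel ∧ M.hom ∘ Sum.elim a z ∈ D' ∧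
        ∀ j, Sum.elim a z ∉ (χ j).sol M.rel) := by
  classical
  obtain ⟨D₁, hD₁, hD₁'⟩ := h.exists_between
  let fin : J → Prop := fun j => ((χ j).atZero.sol P).relIndex (ψ.atZero.sol P) ≠ 0
  -- a tuple that avoids the cosets of finite index can be moved within the intersection of their
  -- subgroups so as to avoid the other cosets as well, keeping the value of `f` in `D'`
  refine (exists_avoiding_of_finiteIndex ψ (fun j : {j // fin j} => χ j) (fun j => j.2) hD₁).mono
    (fun M a ⟨z, h1, h2, h3⟩ => ⟨z, h1, h2, fun j => h3 j⟩) ?_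
  rintro M a ⟨z, hzψ, hzD, hzχ⟩
  by_contra! hcov
  let G : AddSubgroup (κ → M.carrier) :=
    (⨅ j : {j // fin j}, (χ j).atZero.sol M.rel) ⊓ ψ.atZero.sol M.rel
  have hG : G.relIndex (ψ.atZero.sol M.rel) ≠ 0 := by
    rw [AddSubgroup.inf_relIndex_right]
    exact AddSubgroup.relIndex_iInf_ne_zero fun j => by rw [M.relIndex_eq]; exact j.2
  have hU := ((isOpen_interior (s := D')).preimage
    (continuous_add_elim (M.hom ∘ Sum.elim a z))).mem_nhds (x := 0) (by
      simpa using hD₁'.3 hzD)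
  have hq : ∀ j : {j // ¬fin j}, ∃ q : κ → M.carrier, ∀ g,
      Sum.elim a (z + g) ∈ (χ j).sol M.rel → g - q ∈ (χ j).atZero.sol M.rel := by
    intro j
    by_cases hp : ∃ p : κ → M.carrier, Sum.elim a p ∈ (χ j).sol M.rel
    · obtain ⟨p, hp⟩ := hp
      refine ⟨p - z, fun g hg => ?_⟩
      convert (PPFormula.elim_mem_sol_iff hp).1 hg using 1
      abel
    · exact ⟨0, fun g hg => absurd ⟨_, hg⟩ hp⟩
  choose q hq using hq
  obtain ⟨j, hj⟩ := exists_relIndex_ne_zero_of_cover (M.hom.compLeft κ) G hU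
    (fun j : {j // ¬fin j} => (χ j).atZero.sol M.rel) q (fun g hg hgU => by
      obtain ⟨hg1, hg2⟩ := AddSubgroup.mem_inf.1 hg
      rw [AddSubgroup.mem_iInf] at hg1
      obtain ⟨j, hj⟩ := hcov (z + g)
        ((PPFormula.elim_mem_sol_iff hzψ).2 (by simpa using hg2))
        (by rw [comp_elim_add]; exact interior_subset hgU)
      have hjfin : ¬fin j := fun hjfin => hzχ ⟨j, hjfin⟩ ((PPFormula.elim_mem_sol_iff hj).2 (by
        simpa using neg_mem (hg1 ⟨j, hjfin⟩)))
      exact ⟨⟨j, hjfin⟩, hq ⟨j, hjfin⟩ g hj⟩)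
  refine j.2 ?_
  have h1 := AddSubgroup.relIndex_ne_zero_trans hj hG
  rwa [M.relIndex_eq] at h1

theorem eliminable_true {τ : Type} [Finite τ] :
    Eliminable (P := P) (f := f) (fun (_ : AbelianModel.{v, w, x, y} P f) (_ : ι ⊕ τ → _) => True)
      (fun _ _ => True) := by
  intro κ _ ψ D D' h l
  let e := (Equiv.sumAssoc ι τ κ)
  have hc : Continuous fun c : ι ⊕ (τ ⊕ κ) → 𝕋 => c ∘ e := by fun_prop
  have he : ∀ {B : Type _} (a : ι → B) (u : τ → B) (z : κ → B),
      Sum.elim a (Sum.elim u z) ∘ e = Sum.elim (Sum.elim a u) z := by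
    intro B a u z
    ext ((i | i) | i) <;> rfl
  have he' : ∀ {B : Type _} (a : ι → B) (u : τ → B) (z : κ → B),
      Sum.elim a (Sum.elim u z) ∘ Sum.map id Sum.inl = Sum.elim a u := by
    intro B a u z
    ext (i | i) <;> rfl
  refine (exists_avoiding (P := P) (f := f) (ψ.relabel e)
    (fun j : Fin l.length => (l.get j).relabel (Sum.map id Sum.inl)) (h.preimage hc)).mono ?_ ?_
  · rintro M a ⟨u, -, ⟨z, h1, h2⟩, h3⟩
    refine ⟨Sum.elim u z, ?_, ?_, fun j => ?_⟩
    · rwa [PPFormula.mem_sol_relabel, he]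
    · rwa [Set.mem_preimage, Function.comp_assoc, he]
    · rw [PPFormula.mem_sol_relabel, he']
      exact h3 _ (l.get_mem j)
  · rintro M a ⟨z, h1, h2, h3⟩
    obtain ⟨u, z, rfl⟩ : ∃ (u : τ → M.carrier) (z' : κ → M.carrier), z = Sum.elim u z' :=
      ⟨z ∘ Sum.inl, z ∘ Sum.inr, by simp⟩
    refine ⟨u, trivial, ⟨z, ?_, ?_⟩, fun χ hχ => ?_⟩
    · rwa [PPFormula.mem_sol_relabel, he] at h1
    · rwa [Set.mem_preimage, Function.comp_assoc, he] at h2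
    · obtain ⟨j, rfl⟩ := List.get_of_mem hχ
      have := h3 j
      rwa [PPFormula.mem_sol_relabel, he'] at this

theorem ex {τ : Type} [Finite τ] {R R' : UniformPred.{v, w, x, y} P f (ι ⊕ τ)}
    (h : Interpolates R R') :
    Interpolates (fun M a => ∃ u : τ → M.carrier, R M (Sum.elim a u))
      (fun M a => ∃ u : τ → M.carrier, R' M (Sum.elim a u)) := by
  refine (Eliminable.and h eliminable_true Empty .top _ _ .univ []).mono ?_ ?_
  · rintro M a ⟨u, hu⟩
    exact ⟨u, ⟨hu, trivial⟩, ⟨Empty.elim, by simp, trivial⟩, by simp⟩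
  · rintro M a ⟨u, ⟨hu, -⟩, -⟩
    exact ⟨u, hu⟩

end Interpolates

end Elimination

/-! ### Interpolation of CL-formulas -/

section Formulas

open FirstOrder Language

variable {S : ℕ → Type v} {A : Type y} [AddCommGroup A] {P : ∀ n, S n → AddSubgroup (Fin n → A)}
  {𝕋 : Type w} [AddCommGroup 𝕋] [TopologicalSpace 𝕋] [IsTopologicalAddGroup 𝕋]
  [CompactSpace 𝕋] [T2Space 𝕋] {f : A →+ 𝕋}

/-- The CL-structure of an approximate model. -/
abbrev AbelianModel.toCL (M : AbelianModel.{v, w, x, y} P f) :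
    CLStructure.{0, v, w, x} (abelianLanguage S) 𝕋 := abelianCLStructure M.rel M.hom

/-- Quantification over the last variable indexed by `Fin (n + 1)`. -/
theorem Interpolates.ex_snoc {m n : ℕ}
    {R R' : ∀ M : AbelianModel.{v, w, x, y} P f, (Fin m → M.carrier) → (Fin (n + 1) → M.carrier) →
      Prop}
    (h : Interpolates (fun M (a : Fin m ⊕ Fin (n + 1) → _) => R M (a ∘ Sum.inl) (a ∘ Sum.inr))
      (fun M a => R' M (a ∘ Sum.inl) (a ∘ Sum.inr))) :
    Interpolates (fun M (a : Fin m ⊕ Fin n → _) =>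
        ∃ c, R M (a ∘ Sum.inl) (Fin.snoc (α := fun _ => M.carrier) (a ∘ Sum.inr) c))
      (fun M a =>
        ∃ c, R' M (a ∘ Sum.inl) (Fin.snoc (α := fun _ => M.carrier) (a ∘ Sum.inr) c)) := by
  let e : Fin m ⊕ Fin (n + 1) → (Fin m ⊕ Fin n) ⊕ Unit :=
    Sum.elim (fun i => .inl (.inl i))
      (Fin.snoc (α := fun _ => (Fin m ⊕ Fin n) ⊕ Unit) (fun i => .inl (.inr i)) (.inr ()))
  have he : ∀ (M : AbelianModel.{v, w, x, y} P f) (a : Fin m ⊕ Fin n → M.carrier)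
      (u : Unit → M.carrier), (Sum.elim a u ∘ e) ∘ Sum.inr =
        Fin.snoc (α := fun _ => M.carrier) (a ∘ Sum.inr) (u ()) := by
    intro M a u
    ext i
    refine Fin.lastCases ?_ (fun i => ?_) i <;> simp [e]
  refine (h.relabel e).ex.mono ?_ ?_
  · rintro M a ⟨c, hc⟩
    refine ⟨fun _ => c, ?_⟩
    rw [he]
    exact hc
  · rintro M a ⟨u, hu⟩
    rw [he] at hu
    exact ⟨u (), hu⟩

theorem Interpolates.all_snoc {m n : ℕ}
    {R R' : ∀ M : AbelianModel.{v, w, x, y} P f, (Fin m → M.carrier) → (Fin (n + 1) → M.carrier) →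
      Prop}
    (h : Interpolates (fun M (a : Fin m ⊕ Fin (n + 1) → _) => R M (a ∘ Sum.inl) (a ∘ Sum.inr))
      (fun M a => R' M (a ∘ Sum.inl) (a ∘ Sum.inr))) :
    Interpolates (fun M (a : Fin m ⊕ Fin n → _) =>
        ∀ c, R M (a ∘ Sum.inl) (Fin.snoc (α := fun _ => M.carrier) (a ∘ Sum.inr) c))
      (fun M a => ∀ c, R' M (a ∘ Sum.inl) (Fin.snoc (α := fun _ => M.carrier) (a ∘ Sum.inr) c)) :=
  (Interpolates.ex_snoc (R := fun M a b => ¬R' M a b) (R' := fun M a b => ¬R M a b) h.not).not.mono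
    (fun M a h h' => h'.elim fun c hc => hc (h c))
    (fun M a h => by simpa using h)

/-- First order formulas are equivalent to positive combinations of pp-formulas and negated
pp-formulas. -/
theorem interpolates_formula {m n : ℕ} (φ : (abelianLanguage S).BoundedFormula (Fin m) n) :
    Interpolates (P := P) (f := f)
      (fun (M : AbelianModel.{v, w, x, y} P f) a =>
        (CLFormula.fo (C := 𝕋) φ).Realize M.toCL (a ∘ Sum.inl) (a ∘ Sum.inr))
      (fun M a => (CLFormula.fo (C := 𝕋) φ).Realize M.toCL (a ∘ Sum.inl) (a ∘ Sum.inr)) := by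
  induction φ with
  | falsum => exact Interpolates.false
  | equal t₁ t₂ =>
    have key : ∀ (M : AbelianModel.{v, w, x, y} P f) (a : Fin m ⊕ Fin _ → M.carrier),
        (CLFormula.fo (C := 𝕋) (.equal t₁ t₂)).Realize M.toCL (a ∘ Sum.inl) (a ∘ Sum.inr) ↔
          a ∈ (PPFormula.ofAtom (.eq t₁ t₂)).sol M.rel := by
      intro M a
      refine Iff.trans ?_ (PPFormula.mem_sol_ofAtom M.rel).symm
      have h := AbAtom.realize_toBounded M.rel (.eq t₁ t₂) (a ∘ Sum.inl) (a ∘ Sum.inr)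
      rw [Sum.elim_comp_inl_inr] at h
      exact h
    exact (Interpolates.pp _).mono (fun M a => (key M a).1) (fun M a => (key M a).2)
  | rel R ts =>
    have key : ∀ (M : AbelianModel.{v, w, x, y} P f) (a : Fin m ⊕ Fin _ → M.carrier),
        (CLFormula.fo (C := 𝕋) (.rel R ts)).Realize M.toCL (a ∘ Sum.inl) (a ∘ Sum.inr) ↔
          a ∈ (PPFormula.ofAtom (.rel R ts)).sol M.rel := by
      intro M a
      refine Iff.trans ?_ (PPFormula.mem_sol_ofAtom M.rel).symm
      have h := AbAtom.realize_toBounded M.rel (.rel R ts) (a ∘ Sum.inl) (a ∘ Sum.inr)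
      rw [Sum.elim_comp_inl_inr] at h
      exact h
    exact (Interpolates.pp _).mono (fun M a => (key M a).1) (fun M a => (key M a).2)
  | imp φ ψ ihφ ihψ =>
    refine (ihφ.not.or ihψ).mono (fun M a h => ?_) (fun M a h => ?_)
    · by_cases h' : (CLFormula.fo (C := 𝕋) φ).Realize M.toCL (a ∘ Sum.inl) (a ∘ Sum.inr)
      · exact .inr (h h')
      · exact .inl h'
    · exact fun h' => h.elim (fun h => absurd h' h) id
  | all φ ih =>
    exact ih.all_snoc (R := fun M a b => (CLFormula.fo (C := 𝕋) φ).Realize M.toCL a b)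
      (R' := fun M a b => (CLFormula.fo (C := 𝕋) φ).Realize M.toCL a b)

/-- Every CL-formula and every approximation to it are interpolated by the same positive combination
in all approximate models. -/
theorem interpolates_approx {m n : ℕ} {φ φ' : CLFormula (abelianLanguage S) 𝕋 (Fin m) n}
    (h : φ.Approx φ') :
    Interpolates (P := P) (f := f)
      (fun (M : AbelianModel.{v, w, x, y} P f) a =>
        φ.Realize M.toCL (a ∘ Sum.inl) (a ∘ Sum.inr))
      (fun M a => φ'.Realize M.toCL (a ∘ Sum.inl) (a ∘ Sum.inr)) := by
  induction h with
  | fo φ => exact interpolates_formula φ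
  | @mem n k D D' h ts =>
    let F : ((Fin m ⊕ Fin n) ⊕ Empty → 𝕋) → Fin k → 𝕋 :=
      fun c i => termHom 𝕋 (ts i) (c ∘ Sum.inl)
    have hF : Continuous F := continuous_pi fun i =>
      (continuous_termHom (ts i)).comp (by fun_prop)
    have key : ∀ (M : AbelianModel.{v, w, x, y} P f) (a : Fin m ⊕ Fin n → M.carrier)
        (z : Empty → M.carrier) (D : Closeds (Fin k → 𝕋)),
        (CLFormula.mem D ts).Realize M.toCL (a ∘ Sum.inl) (a ∘ Sum.inr) ↔
          F (M.hom ∘ Sum.elim a z) ∈ D := by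
      intro M a z D
      have : (fun i => M.hom (@Term.realize _ _ (abelianStructure M.rel) _
          (Sum.elim (a ∘ Sum.inl) (a ∘ Sum.inr)) (ts i))) = F (M.hom ∘ Sum.elim a z) := by
        ext i
        rw [realize_eq_termHom, termHom_comp, Sum.elim_comp_inl_inr]
        rfl
      rw [← this]
      rfl
    refine (Interpolates.ppValue .top ((ClosedNhd.of_closedApprox h).preimage hF)).mono ?_ ?_
    · intro M a h
      exact ⟨Empty.elim, by simp, (key M a _ D).1 h⟩
    · rintro M a ⟨z, -, h⟩
      exact (key M a z D').2 h
  | and _ _ ih₁ ih₂ => exact ih₁.and ih₂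
  | or _ _ ih₁ ih₂ => exact ih₁.or ih₂
  | @ex n φ φ' _ ih =>
    exact ih.ex_snoc (R := fun M a b => φ.Realize M.toCL a b)
      (R' := fun M a b => φ'.Realize M.toCL a b)
  | @all n φ φ' _ ih =>
    exact ih.all_snoc (R := fun M a b => φ.Realize M.toCL a b)
      (R' := fun M a b => φ'.Realize M.toCL a b)

end Formulas

/-! ### Boxes -/

section Boxes

open FirstOrder Language

variable {L : FirstOrder.Language.{u, v}} {C : Type w} [TopologicalSpace C]

namespace CLFormula

/-- The formula `∃ y (φ(x, y) ∧ ⋀ᵢ f(xᵢ) ∈ Vᵢ ∧ ⋀_{j ∈ J} f(y_j) ∈ W_j)`. -/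
def box {m k : ℕ} (φ : L.BoundedFormula (Fin m) k) (J : Finset (Fin k))
    (V : Fin m → Closeds (Fin 1 → C)) (W : Fin k → Closeds (Fin 1 → C)) :
    CLFormula L C (Fin m) 0 :=
  exs (and (fo φ) (and
    (conj (((List.finRange m).filter (· ∈ Finset.univ)).map
      fun i => mem (k := 1) (V i) fun _ => .var (.inl i)))
    (conj (((List.finRange k).filter (· ∈ J)).map
      fun j => mem (k := 1) (W j) fun _ => .var (.inr j)))))

theorem isPPStar_box [T1Space C] {m k : ℕ} {φ : L.BoundedFormula (Fin m) k} (hφ : IsAtomicConj φ)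
    (J : Finset (Fin k)) (c : Fin m → C) (d : Fin k → C) :
    IsPPStar (box φ J (fun i => ⟨{fun _ => c i}, isClosed_singleton⟩)
      fun j => ⟨{fun _ => d j}, isClosed_singleton⟩) :=
  ⟨k, φ, Finset.univ, c, J, d, hφ, rfl⟩

theorem approx_conj_map {ι : Type*} {α : Type*} {n : ℕ} {φ φ' : ι → CLFormula L C α n}
    (h : ∀ i, (φ i).Approx (φ' i)) (l : List ι) : (conj (l.map φ)).Approx (conj (l.map φ')) := by
  induction l with
  | nil => exact .fo _
  | cons i l ih => exact .and (h i) ih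

theorem approx_box {m k : ℕ} (φ : L.BoundedFormula (Fin m) k) (J : Finset (Fin k))
    {V V' : Fin m → Closeds (Fin 1 → C)} {W W' : Fin k → Closeds (Fin 1 → C)}
    (hV : ∀ i, ClosedApprox (V i) (V' i)) (hW : ∀ j, ClosedApprox (W j) (W' j)) :
    (box φ J V W).Approx (box φ J V' W') :=
  .exs (.and (.fo φ) (.and (approx_conj_map (fun i => .mem (hV i) _) _)
    (approx_conj_map (fun j => .mem (hW j) _) _)))

theorem realize_box {N : CLStructure.{u, v, w, x} L C} {m k : ℕ}
    {φ : L.BoundedFormula (Fin m) k} {J : Finset (Fin k)}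
    {V : Fin m → Closeds (Fin 1 → C)} {W : Fin k → Closeds (Fin 1 → C)} {a : Fin m → N.carrier}
    {b₀ : Fin 0 → N.carrier} :
    (box φ J V W).Realize N a b₀ ↔ ∃ b : Fin k → N.carrier, φ.Realize a b ∧
      (∀ i, (fun _ => N.toFun (a i)) ∈ V i) ∧ ∀ j ∈ J, (fun _ => N.toFun (b j)) ∈ W j := by
  rw [box, realize_exs]
  simp [Realize, realize_conj]

end CLFormula

variable {X : Type*} [TopologicalSpace X]

/-- The closed subset of `X^1` given by a closed subset of `X`. -/
def closedsOne (V : Set X) (h : IsClosed V) : Closeds (Fin 1 → X) :=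
  ⟨(fun c => c 0) ⁻¹' V, h.preimage (continuous_apply 0)⟩

theorem ClosedNhd.closedApprox_one {V V' : Set X} (h : ClosedNhd V V') :
    ClosedApprox (closedsOne V h.1) (closedsOne V' h.2) :=
  ClosedNhd.closedApprox (h.preimage (continuous_apply 0))

theorem ClosedNhd.closedApprox_singleton [T1Space X] {c : X} {V' : Set X}
    (h : ClosedNhd {c} V') :
    ClosedApprox ⟨{fun _ : Fin 1 => c}, isClosed_singleton⟩ (closedsOne V' h.2) := by
  refine ⟨(fun d => d 0) ⁻¹' interior V', isOpen_interior.preimage (continuous_apply 0), ?_,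
    Set.preimage_mono interior_subset⟩
  rintro _ rfl
  exact h.3 rfl

/-- Inside a neighbourhood of a point of a power of a normal space there are two nested boxes of
closed neighbourhoods. -/
theorem exists_box [T4Space X] {ι : Type*} [Finite ι] {c : ι → X} {U : Set (ι → X)}
    (hU : IsOpen U) (hc : c ∈ U) : ∃ V V' : ι → Set X, (∀ i, ClosedNhd {c i} (V i)) ∧
      (∀ i, ClosedNhd (V i) (V' i)) ∧ Set.univ.pi V' ⊆ U := by
  obtain ⟨u, hu, huU⟩ := isOpen_pi_iff'.1 hU c hc
  have h : ∀ i, ∃ V V', ClosedNhd {c i} V ∧ ClosedNhd V V' ∧ V' ⊆ u i := by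
    intro i
    obtain ⟨V', h1, h2⟩ := ClosedNhd.exists_disjoint (isClosed_singleton (x := c i))
      (hu i).1.isClosed_compl (by simpa using (hu i).2)
    obtain ⟨V, h3, h4⟩ := h1.exists_between
    exact ⟨V, V', h3, h4, by simpa using Set.subset_compl_iff_disjoint_right.2 h2⟩
  choose V V' h1 h2 h3 using h
  exact ⟨V, V', h1, h2, (Set.pi_mono fun i _ => h3 i).trans huU⟩

end Boxes

/-! ### Interpolants built from `pp*`-formulas -/

section Final

open FirstOrder Language

variable {S : ℕ → Type v} {A : Type y} [AddCommGroup A] {P : ∀ n, S n → AddSubgroup (Fin n → A)}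
  {𝕋 : Type w} [AddCommGroup 𝕋] [TopologicalSpace 𝕋] {f : A →+ 𝕋}

theorem AbelianModel.realize_fo_not {m : ℕ} (M : AbelianModel.{v, w, x, y} P f)
    (χ : PPFormula S (Fin m)) (a : Fin m → M.carrier) (b : Fin 0 → M.carrier) :
    (CLFormula.fo (C := 𝕋) (BoundedFormula.not χ.toFormula)).Realize M.toCL a b ↔
      a ∉ χ.sol M.rel := by
  rw [← PPFormula.realize_toFormula M.rel]
  have : b = default := Subsingleton.elim _ _
  subst this
  exact @BoundedFormula.realize_not _ _ (abelianStructure M.rel) _ _ _ _ _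

variable [CompactSpace 𝕋] [T2Space 𝕋]

/-- By compactness, a closed set lies in a finite union of boxes inside a given closed neighbourhood
of it, and a box defines an approximation to a `pp*`-formula. -/
theorem exists_inPPClosure_ppValue {m : ℕ} {κ : Type} [Finite κ] (ψ : PPFormula S (Fin m ⊕ κ))
    {D D' : Set (Fin m ⊕ κ → 𝕋)} (h : ClosedNhd D D') :
    ∃ θ θ' : CLFormula (abelianLanguage S) 𝕋 (Fin m) 0, InPPClosure θ ∧ θ.Approx θ' ∧
      ∀ (M : AbelianModel.{v, w, x, y} P f) (a : Fin m → M.carrier),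
        (ppValue ψ D M a → θ.Realize M.toCL a Fin.elim0) ∧
        (θ'.Realize M.toCL a Fin.elim0 → ppValue ψ D' M a) := by
  classical
  let k := Nat.card (κ ⊕ ψ.β)
  let e : (κ ⊕ ψ.β) ≃ Fin k := Finite.equivFin (κ ⊕ ψ.β)
  have := Fintype.ofFinite κ
  -- `J` consists of the variables `κ` of `ψ`; its bound variables get no condition on their values
  let J : Finset (Fin k) := Finset.univ.image fun i : κ => e (.inl i)
  have hbox : ∀ c : D, ∃ V V' : Fin m ⊕ κ → Set 𝕋, (∀ i, ClosedNhd {c.1 i} (V i)) ∧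
      (∀ i, ClosedNhd (V i) (V' i)) ∧ Set.univ.pi V' ⊆ interior D' :=
    fun c => exists_box isOpen_interior (h.3 c.2)
  choose V V' hV hV' hVD using hbox
  let d : D → Fin k → 𝕋 := fun c j => Sum.elim (fun i => c.1 (.inr i)) (fun _ => 0) (e.symm j)
  let W : D → Fin k → Set 𝕋 := fun c j =>
    Sum.elim (fun i => V c (.inr i)) (fun _ => Set.univ) (e.symm j)
  let W' : D → Fin k → Set 𝕋 := fun c j =>
    Sum.elim (fun i => V' c (.inr i)) (fun _ => Set.univ) (e.symm j)
  have hW : ∀ c j, ClosedNhd {d c j} (W c j) := by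
    intro c j
    simp only [d, W]
    rcases e.symm j with i | i
    · exact hV c _
    · exact ⟨isClosed_singleton, isClosed_univ, by simp⟩
  have hW' : ∀ c j, ClosedNhd (W c j) (W' c j) := by
    intro c j
    simp only [W, W']
    rcases e.symm j with i | i
    · exact hV' c _
    · exact .univ
  let θ : D → CLFormula (abelianLanguage S) 𝕋 (Fin m) 0 := fun c =>
    .box ψ.ex.matrix J (fun i => closedsOne _ (hV c (.inl i)).2) fun j => closedsOne _ (hW c j).2
  let θ' : D → CLFormula (abelianLanguage S) 𝕋 (Fin m) 0 := fun c =>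
    .box ψ.ex.matrix J (fun i => closedsOne _ (hV' c (.inl i)).2) fun j => closedsOne _ (hW' c j).2
  have hθ : ∀ c, InPPClosure (θ c) := fun c =>
    .approx (.ppStar (CLFormula.isPPStar_box (AbAtom.isAtomicConj_conj _) J
      (fun i => c.1 (.inl i)) (d c)))
      (CLFormula.approx_box _ _ (fun i => (hV c _).closedApprox_singleton)
        fun j => (hW c j).closedApprox_singleton)
  have hθθ' : ∀ c, (θ c).Approx (θ' c) := fun c =>
    CLFormula.approx_box _ _ (fun i => (hV' c _).closedApprox_one)
      fun j => (hW' c j).closedApprox_one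
  have hreal : ∀ (c : D) (M : AbelianModel.{v, w, x, y} P f) (a : Fin m → M.carrier)
      (z : κ → M.carrier), Sum.elim a z ∈ ψ.sol M.rel →
      (∀ i, (M.hom ∘ Sum.elim a z) i ∈ V c i) → (θ c).Realize M.toCL a Fin.elim0 := by
    rintro c M a z ⟨b, hb⟩ hz
    refine CLFormula.realize_box.2 ⟨Sum.elim z b ∘ e.symm, ?_, fun i => hz (.inl i), ?_⟩
    · refine (PPFormula.realize_matrix M.rel).2 ((PPFormula.forall_atoms_ex M.rel).2 ?_)
      have : (Sum.elim z b ∘ e.symm) ∘ Finite.equivFin (κ ⊕ ψ.β) = Sum.elim z b := by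
        ext i; simp [e]
      change ∀ φ ∈ ψ.atoms, Sum.elim (Sum.elim a
        (((Sum.elim z b ∘ e.symm) ∘ Finite.equivFin (κ ⊕ ψ.β)) ∘ Sum.inl))
        (((Sum.elim z b ∘ e.symm) ∘ Finite.equivFin (κ ⊕ ψ.β)) ∘ Sum.inr) ∈ _
      rw [this]
      exact hb
    · intro j hj
      obtain ⟨i, -, rfl⟩ := Finset.mem_image.1 hj
      have h1 : (Sum.elim z b ∘ e.symm) (e (.inl i)) = z i := by simp
      have h2 : W c (e (.inl i)) = V c (.inr i) := by simp [W]
      change M.hom ((Sum.elim z b ∘ e.symm) (e (.inl i))) ∈ W c (e (.inl i))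
      rw [h1, h2]
      exact hz (.inr i)
  have hreal' : ∀ (c : D) (M : AbelianModel.{v, w, x, y} P f) (a : Fin m → M.carrier),
      (θ' c).Realize M.toCL a Fin.elim0 → ppValue ψ D' M a := by
    intro c M a hr
    obtain ⟨b, hb, hbV, hbW⟩ := CLFormula.realize_box.1 hr
    have hb' := (PPFormula.forall_atoms_ex M.rel).1 ((PPFormula.realize_matrix M.rel).1 hb)
    refine ⟨_, ⟨_, hb'⟩, interior_subset (hVD c fun i _ => ?_)⟩
    rcases i with i | i
    · exact hbV i
    · have := hbW (e (.inl i)) (Finset.mem_image_of_mem _ (Finset.mem_univ i))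
      have h1 : M.hom (b (e (.inl i))) ∈ V' c (.inr i) := by
        have h2 : W' c (e (.inl i)) = V' c (.inr i) := by simp [W']
        exact h2 ▸ this
      exact h1
  -- finitely many boxes suffice
  obtain ⟨t, ht⟩ := h.1.isCompact.elim_finite_subcover
    (fun c : D => Set.univ.pi fun i => interior (V c i))
    (fun c => isOpen_set_pi Set.finite_univ fun i _ => isOpen_interior)
    (fun c hc => Set.mem_iUnion.2 ⟨⟨c, hc⟩, fun i _ => (hV ⟨c, hc⟩ i).3 rfl⟩)
  have hfin : ∀ l : List D, ∃ η η' : CLFormula (abelianLanguage S) 𝕋 (Fin m) 0,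
      InPPClosure η ∧ η.Approx η' ∧
      ∀ (M : AbelianModel.{v, w, x, y} P f) (a : Fin m → M.carrier),
        ((∃ c ∈ l, (θ c).Realize M.toCL a Fin.elim0) → η.Realize M.toCL a Fin.elim0) ∧
        (η'.Realize M.toCL a Fin.elim0 → ppValue ψ D' M a) := by
    intro l
    induction l with
    | nil =>
      refine ⟨_, _, .negPP (PPFormula.isPP_toFormula .top), .fo _, fun M a => ⟨by simp, ?_⟩⟩
      exact fun hr => absurd (PPFormula.mem_sol_top M.rel) ((M.realize_fo_not _ a _).1 hr)
    | cons c l ih =>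
      obtain ⟨η, η', h1, h2, h3⟩ := ih
      refine ⟨_, _, .or (hθ c) h1, .or (hθθ' c) h2, fun M a => ⟨?_, ?_⟩⟩
      · rintro ⟨c', hc', hr⟩
        rcases List.mem_cons.1 hc' with rfl | hc'
        · exact .inl hr
        · exact .inr ((h3 M a).1 ⟨c', hc', hr⟩)
      · exact fun hr => hr.elim (hreal' c M a) (h3 M a).2
  obtain ⟨η, η', h1, h2, h3⟩ := hfin t.toList
  refine ⟨η, η', h1, h2, fun M a => ⟨?_, (h3 M a).2⟩⟩
  rintro ⟨z, hz, hzD⟩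
  obtain ⟨c, hc, hcz⟩ := Set.mem_iUnion₂.1 (ht hzD)
  exact (h3 M a).1 ⟨c, by simpa using hc,
    hreal c M a z hz fun i => interior_subset (hcz i trivial)⟩

/-- What is interpolated is interpolated by a formula of the class `Φ`, together with an
approximation to it. -/
theorem Interpolates.exists_inPPClosure {m : ℕ} {R R' : UniformPred.{v, w, x, y} P f (Fin m)}
    (h : Interpolates R R') :
    ∃ θ θ' : CLFormula (abelianLanguage S) 𝕋 (Fin m) 0, InPPClosure θ ∧ θ.Approx θ' ∧
      ∀ (M : AbelianModel.{v, w, x, y} P f) (a : Fin m → M.carrier),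
        (R M a → θ.Realize M.toCL a Fin.elim0) ∧ (θ'.Realize M.toCL a Fin.elim0 → R' M a) := by
  induction h with
  | ppValue ψ h => exact exists_inPPClosure_ppValue ψ h
  | negPP χ =>
    exact ⟨_, _, .negPP (PPFormula.isPP_toFormula χ), .fo _, fun M a =>
      ⟨(M.realize_fo_not χ a _).2, (M.realize_fo_not χ a _).1⟩⟩
  | and _ _ ih₁ ih₂ =>
    obtain ⟨θ₁, θ₁', h11, h12, h13⟩ := ih₁
    obtain ⟨θ₂, θ₂', h21, h22, h23⟩ := ih₂
    exact ⟨_, _, .and h11 h21, .and h12 h22, fun M a =>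
      ⟨fun hr => ⟨(h13 M a).1 hr.1, (h23 M a).1 hr.2⟩,
        fun hr => ⟨(h13 M a).2 hr.1, (h23 M a).2 hr.2⟩⟩⟩
  | or _ _ ih₁ ih₂ =>
    obtain ⟨θ₁, θ₁', h11, h12, h13⟩ := ih₁
    obtain ⟨θ₂, θ₂', h21, h22, h23⟩ := ih₂
    exact ⟨_, _, .or h11 h21, .or h12 h22, fun M a =>
      ⟨fun hr => hr.imp (h13 M a).1 (h23 M a).1, fun hr => hr.imp (h13 M a).2 (h23 M a).2⟩⟩
  | mono _ h₁ h₂ ih =>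
    obtain ⟨θ, θ', h3, h4, h5⟩ := ih
    exact ⟨θ, θ', h3, h4, fun M a =>
      ⟨fun hr => (h5 M a).1 (h₁ M a hr), fun hr => h₂ M a ((h5 M a).2 hr)⟩⟩

/-- Every approximation of CL-formulas is interpolated, together with an approximation to the
interpolant, in all approximate models. -/
theorem exists_inPPClosure_of_approx [IsTopologicalAddGroup 𝕋]
    (P : ∀ n, S n → AddSubgroup (Fin n → A)) (f : A →+ 𝕋) {m : ℕ}
    {φ φ' : CLFormula (abelianLanguage S) 𝕋 (Fin m) 0} (h : φ.Approx φ') :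
    ∃ θ θ' : CLFormula (abelianLanguage S) 𝕋 (Fin m) 0, InPPClosure θ ∧ θ.Approx θ' ∧
      ∀ N : CLStructure.{0, v, w, x} (abelianLanguage S) 𝕋,
        N.IsApproxModel (abelianCLStructure P f).theory → ∀ a : Fin m → N.carrier,
          (φ.Realize N a Fin.elim0 → θ.Realize N a Fin.elim0) ∧
          (θ'.Realize N a Fin.elim0 → φ'.Realize N a Fin.elim0) := by
  obtain ⟨θ, θ', h1, h2, h3⟩ := ((interpolates_approx.{v, w, x, y} (P := P) (f := f) h).relabel
    (Sum.elim id Fin.elim0 : Fin m ⊕ Fin 0 → Fin m)).exists_inPPClosure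
  refine ⟨θ, θ', h1, h2, fun N hN => ?_⟩
  obtain ⟨grp, P', g, hNeq⟩ := exists_eq_abelianCLStructure hN
  rw [hNeq] at hN ⊢
  intro a
  let M : AbelianModel P f := ⟨N.carrier, P', g, hN⟩
  have h0 : ∀ (χ : CLFormula (abelianLanguage S) 𝕋 (Fin m) 0) (b : Fin 0 → M.carrier),
      χ.Realize M.toCL a b ↔ χ.Realize M.toCL a Fin.elim0 := fun χ b => by
    rw [Subsingleton.elim b Fin.elim0]
    exact Iff.rfl
  obtain ⟨h4, h5⟩ := h3 M a
  exact ⟨fun hr => h4 ((h0 _ _).2 hr), fun hr => (h0 _ _).1 (h5 hr)⟩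

end Final

theorem mainTheorem3 {S : ℕ → Type v} {A : Type y} [AddCommGroup A]
    (P : ∀ n, S n → AddSubgroup (Fin n → A))
    {𝕋 : Type w} [AddCommGroup 𝕋] [TopologicalSpace 𝕋] [IsTopologicalAddGroup 𝕋]
    [CompactSpace 𝕋] [T2Space 𝕋] (f : A →+ 𝕋)
    {m : ℕ} (φ φ' : CLFormula (abelianLanguage S) 𝕋 (Fin m) 0) (hφ : φ.Approx φ') :
    ∃ θ : CLFormula (abelianLanguage S) 𝕋 (Fin m) 0, InPPClosure θ ∧
      ∀ N : CLStructure.{0, v, w, x} (abelianLanguage S) 𝕋,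
        N.IsApproxModel (abelianCLStructure P f).theory →
        (∀ κ : Cardinal.{x}, Cardinal.aleph0 ≤ κ → N.IsSaturated κ →
          ∀ a : Fin m → N.carrier,
            (φ.Realize N a Fin.elim0 → θ.Realize N a Fin.elim0) ∧
            (θ.Realize N a Fin.elim0 → φ'.Realize N a Fin.elim0)) ∧
        (∀ a : Fin m → N.carrier,
            (φ.ApproxRealize N a Fin.elim0 → θ.ApproxRealize N a Fin.elim0) ∧
            (θ.ApproxRealize N a Fin.elim0 → φ'.ApproxRealize N a Fin.elim0)) := by
  obtain ⟨ψ, hφψ, hψφ'⟩ := hφ.exists_between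
  obtain ⟨θ, θ', hθ, hθθ', h⟩ := exists_inPPClosure_of_approx P f hψφ'
  refine ⟨θ, hθ, fun N hN => ⟨fun κ _ _ a => ⟨fun hr => ?_, fun hr => ?_⟩,
    fun a => ⟨fun hr => ?_, fun hr => ?_⟩⟩⟩
  -- there are approximations `φ'` to `ψ`, `ψ` to `φ`, and `θ'` to `θ`, with `ψ → θ` and `θ' → φ'`;
  -- satisfaction passes to approximations, and approximate satisfaction of a formula gives
  -- satisfaction of its approximations
  · exact (h N hN a).1 (hr.approx hφψ)
  · exact (h N hN a).2 (hr.approx hθθ')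
  · exact ((h N hN a).1 (hr ψ hφψ)).approxRealize
  · exact ((h N hN a).2 (hr θ' hθθ')).approxRealize
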